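/- **Setting.** Let $D\subset\mathbb R^3$ be compact and $D\subseteq W\subseteq\mathbb R^3$. A pose $g=(p,R)\in\mathbb R^3\times SO(3)$ is identified with its homogeneous matrix and has the vector form $\check g=(p,\xi\theta)\in\mathbb R^6$ (unit axis $\xi$, angle $\theta\in(-\pi,\pi]$). For a set $A$ of positions let $\mathcal X_A=\{\check g: p\in A\}$. A hat denotes the map $\mathbb R^6\to se(3)$ (or $\mathbb R^3\to so(3)$). Write $\mathrm{vec}(g)=(p,((R-R^\top)/2)^\vee)$, $\mathrm{Ad}_g=\begin{bmatrix}R&\hat pR\\0&R\end{bmatrix}$, $\mathrm{Ad}_R=\mathrm{diag}(R,R)$; $\|\cdot\|$ is the Euclidean norm. *Models.* For $\psi\in\Psi=\{1,\dots,\bar M\}$ let $k_\psi(x,x')=\sigma_{f,\psi}^2\exp(-\frac12(x-x')^\top\Lambda_\psi(x-x'))$ with $\sigma_{f,\psi}>0$ and $\Lambda_\psi$ symmetric positive semidefinite, and let $v_\psi:\mathcal X_W\to\mathbb R^6$ be a motion profile all of whose components $[v_\psi]_i$ lie in the RKHS of $k_\psi$. From $M_\psi$ fixed inputs $x^{\{j\}}\in\mathcal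 X_D$ and measurements $y^{\{j\}}=v_\psi(x^{\{j\}})+\epsilon_\psi^{\{j\}}$, whose noise components are sub-Gaussian with variance proxy $\sigma_{n,\psi,i}^2>0$ (e.g. $\mathcal N(0,\sigma_{n,\psi,i}^2)$) and independent over $j$, form the Gaussian process posterior mean $\mu_\psi$ and the diagonal matrix $\Sigma_\psi$ of posterior variances. For $\delta\in(0,1)$ let $$[\beta_\psi]_i=\sqrt{2\|[v_\psi]_i\|_{k_\psi}^2+300\,[\gamma_\psi]_i\log^3\big((M_\psi+1)/\delta\big)},$$ $[\gamma_\psi]_i$ being the maximum information gain $\sup\frac12\log\det(I+\sigma_{n,\psi,i}^{-2}K_A)$ over $M_\psi$ points of $\mathcal X_D$ with Gram matrix $K_A$. *Closed loop.* Target $\dot g_{wo}=g_{wo}\hat V_{wo}$ with $V_{wo}=v_{s(t)}(\check g_{wo})$; camera $\dot g_{wc}=g_{wc}\hat V_{wc}$; observer $\dot{\bar g}_{co}=-\hat V_{wc}\bar g_{co}-\bar g_{co}\hat u_e$, where the switching signal $s:[0,\infty)\to\Psi$ has finitely many switches in finite time and the poses are continuous. Put $g_{co}=g_{wc}^{-1}g_{wo}$,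 $\bar g_{wo}=g_{wc}\bar g_{co}$, $g_{ce}=g_d^{-1}\bar g_{co}$ for a fixed desired pose $g_d$, $g_{ee}=\bar g_{co}^{-1}g_{co}$, $e_c=\mathrm{vec}(g_{ce})$, $e_e=\mathrm{vec}(g_{ee})$, $e=(e_c,e_e)$, and $S=\frac12\sum_{j\in\{c,e\}}(\|p_{je}\|^2+\mathrm{tr}(I-R_{je}))$. The switching is known and the control law is $$u=\begin{bmatrix}u_c\\u_e\end{bmatrix}=-K\mathrm Ne-\begin{bmatrix}\mathrm{Ad}_{R_{ce}}\\I\end{bmatrix}\mathrm{Ad}_{R_{ee}}\,\mu_{s(t)}(\check{\bar g}_{wo}),\qquad u_c=-\mathrm{Ad}_{g_d^{-1}}V_{wc},\qquad \mathrm N=\begin{bmatrix}I&0\\-\mathrm{Ad}_{R_{ce}^{-1}}&I\end{bmatrix},$$ with $K=\mathrm{diag}(K_c,K_e)$ and symmetric $K_c,K_e\in\mathbb R^{6\times 6}$. Only solutions on $[0,\infty)$ are considered for which, at all times, the position of $g_{wo}$ is in $D$, that of $\bar g_{wo}$ is in $W$, and $|\theta_{ce}|,|\theta_{ee}|<\pi/2$.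 *Constants.* $\lambda_K$ is the smallest eigenvalue of $\mathrm N^\top K\mathrm N$ (minimized over $R_{ce}\in SO(3)$). $L_{p,\psi},L_{\theta,\psi}\ge0$ are Lipschitz constants of $v_\psi$ on $\mathcal X_W$: $\|v_\psi(\check g)-v_\psi(\check g')\|\le L_{p,\psi}\|p-p'\|+L_{\theta,\psi}\|\xi\theta-\xi'\theta'\|$. Suppose $\tilde\lambda_\psi:=\lambda_K-L_{p,\psi}>0$ for all $\psi$, and let $$c_\psi(x)=\frac{\|\beta_\psi^\top\Sigma_\psi^{1/2}(x)\|}{2\tilde\lambda_\psi}+\frac{\pi L_{\theta,\psi}}{\tilde\lambda_\psi},\qquad E_{\psi,c}=\sqrt{\|e_c\|^2+\tfrac{\tilde\lambda_\psi}{\lambda_K}(\|e_e\|-c)^2}-\sqrt{\tfrac{\tilde\lambda_\psi}{\lambda_K}}\,c .$$ The ellipse $\mathbb B_\psi$ is the set $E_{\psi,c}\le0$ with $c=c_\psi(\check{\bar g}_{wo})$. **Theorem 2.** (1) For every outcome of the noise, $\|e\|$ is uniformly ultimately bounded: there is $b>0$ such that for every $a>0$ there is $T\ge0$ such that for all solutions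 (with arbitrary switching) and all $t_0\ge0$, $\|e(t_0)\|\le a$ implies $\|e(t)\|\le b$ for all $t\ge t_0+T$. (2) There are events $G_\psi$ with $P(G_\psi)\ge1-\delta^6$, $\psi\in\Psi$, such that: (a) on $G_\psi$, along every solution and at every time $t>0$ between switches at which $s(t)=\psi$, $S$ is differentiable and $\dot S<0$ whenever the error is outside $\mathbb B_\psi$; (b) (convergence to the ellipse) for every $\Phi\subseteq\Psi$, $a>0$ and $\varepsilon>0$ there is $T\ge0$ such that on $\bigcap_{\psi\in\Phi}G_\psi$, for every solution and $t_0\ge0$ with $s(t)\in\Phi$ for all $t\ge t_0$ and $\|e(t_0)\|\le a$: at some $t\in[t_0,t_0+T]$ one has $E_{\psi,c}<\varepsilon$ with $\psi=s(t)$, $c=c_\psi(\check{\bar g}_{wo}(t))$; and $S(t)\le r+\varepsilon$ for all $t\ge t_0+T$ whenever the sublevel set $\{S\le r\}$ contains (among error poses with rotation angles at most $\pi/2$) the ellipses $E_{\psi,\bar c_\psi}\le0$, $\bar c_\psi=\sup_{x\in\mathcal X_W}c_\psi(x)$, for all $\psi\in\Phi$. In particular, $\Phi=\{\psi\}$ gives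 convergence, with probability at least $1-\delta^6$, while model $\psi$ is active. -/

import Mathlib

open MeasureTheory ProbabilityTheory Filter Topology Matrix
open scoped NNReal

noncomputable section

namespace VisualPursuit

/-- Index set of the six coordinates of a pose vector or a body velocity:
the left three are translational, the right three rotational. -/
abbrev I6 := Fin 3 ⊕ Fin 3

/-- The Euclidean norm. -/
def euc {ι : Type*} [Fintype ι] (x : ι → ℝ) : ℝ := ‖WithLp.toLp 2 x‖

/-! ### Rigid body motion -/

/-- The wedge operator on `ℝ³`. -/
def hat (a : Fin 3 → ℝ) : Matrix (Fin 3) (Fin 3) ℝ :=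
  !![0, -a 2, a 1; a 2, 0, -a 0; -a 1, a 0, 0]

/-- The wedge operator computes the cross product. -/
theorem hat_mulVec (a b : Fin 3 → ℝ) : hat a *ᵥ b = crossProduct a b := by
  ext i
  fin_cases i <;> simp [hat, cross_apply, Matrix.mulVec, dotProduct, Fin.sum_univ_three] <;> ring

/-- The vee operator, inverse of the wedge operator on skew-symmetric matrices. -/
def vee (A : Matrix (Fin 3) (Fin 3) ℝ) : Fin 3 → ℝ := ![A 2 1, A 0 2, A 1 0]

theorem vee_hat (a : Fin 3 → ℝ) : vee (hat a) = a := by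
  ext i
  fin_cases i <;> simp [hat, vee]

/-- The rotation matrices. -/
abbrev SO3 := Matrix.specialOrthogonalGroup (Fin 3) ℝ

/-- A rigid body pose, an element of `SE(3) = ℝ³ × SO(3)`. -/
@[ext] structure Pose where
  pos : Fin 3 → ℝ
  rot : SO3

namespace Pose

/-- The rotation matrix of a pose. -/
def R (g : Pose) : Matrix (Fin 3) (Fin 3) ℝ := g.rot

/-- The homogeneous representation. -/
def homog (g : Pose) : Matrix (Fin 3 ⊕ Unit) (Fin 3 ⊕ Unit) ℝ :=
  Matrix.fromBlocks g.R (Matrix.replicateCol Unit g.pos) 0 1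

/-- The product in `SE(3)`. -/
def mul (g h : Pose) : Pose := ⟨g.pos + g.R *ᵥ h.pos, g.rot * h.rot⟩

/-- The inverse in `SE(3)`. -/
def inv (g : Pose) : Pose := ⟨-(g.Rᵀ *ᵥ g.pos), g.rot⁻¹⟩

/-- `homog` turns the product of poses into the matrix product. -/
theorem homog_mul (g h : Pose) : (g.mul h).homog = g.homog * h.homog := by
  simp only [homog, mul, R, Matrix.fromBlocks_multiply]
  congr 1
  · simp
  · ext i j
    simp [Matrix.mul_apply, Matrix.mulVec, dotProduct, add_comm]
  · simp
  · simp

/-- The adjoint matrix of a pose. -/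
def Ad (g : Pose) : Matrix I6 I6 ℝ :=
  Matrix.fromBlocks g.R (hat g.pos * g.R) 0 g.R

/-- The error vector `(p, sk(R)^∨)` of a pose, `sk(R) = (R - R⁻¹) / 2`. -/
def errVec (g : Pose) : I6 → ℝ :=
  Sum.elim g.pos (vee ((1 / 2 : ℝ) • (g.R - g.Rᵀ)))

end Pose

/-- The adjoint matrix of a pure rotation. -/
def AdRot (R : Matrix (Fin 3) (Fin 3) ℝ) : Matrix I6 I6 ℝ := Matrix.fromBlocks R 0 0 R

/-- The homogeneous matrix in `se(3)` of a body velocity. -/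
def twistHat (V : I6 → ℝ) : Matrix (Fin 3 ⊕ Unit) (Fin 3 ⊕ Unit) ℝ :=
  Matrix.fromBlocks (hat (V ∘ Sum.inr)) (Matrix.replicateCol Unit (V ∘ Sum.inl)) 0 0

/-- The rotation by the angle `θ` about the unit axis `ξ` (Rodrigues' form of `exp (θ ξ^)`). -/
def axisRot (ξ : Fin 3 → ℝ) (θ : ℝ) : Matrix (Fin 3) (Fin 3) ℝ :=
  Real.cos θ • (1 : Matrix (Fin 3) (Fin 3) ℝ) + Real.sin θ • hat ξ
    + (1 - Real.cos θ) • Matrix.vecMulVec ξ ξ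

/-- `(ξ, θ)` is an Euler axis and a rotation angle in `(-π, π]` of `R`. -/
def IsAxisAngle (R : Matrix (Fin 3) (Fin 3) ℝ) (ξ : Fin 3 → ℝ) (θ : ℝ) : Prop :=
  euc ξ = 1 ∧ -Real.pi < θ ∧ θ ≤ Real.pi ∧ R = axisRot ξ θ

open Classical in
/-- The axis-angle vector `ξ θ` of `R` (with a fixed choice at half turns, where it is not
unique; every rotation matrix has an axis and an angle). -/
def axisAngle (R : Matrix (Fin 3) (Fin 3) ℝ) : Fin 3 → ℝ :=
  if h : ∃ q : (Fin 3 → ℝ) × ℝ, IsAxisAngle R q.1 q.2 then h.choose.2 • h.choose.1 else 0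

/-- The vector form `(p, ξ θ)` of a pose. -/
def Pose.vec (g : Pose) : I6 → ℝ := Sum.elim g.pos (axisAngle g.R)

/-- The set `D × SO(3)` in vector form. -/
def poseVecs (D : Set (Fin 3 → ℝ)) : Set (I6 → ℝ) := {x | ∃ g : Pose, g.pos ∈ D ∧ g.vec = x}

/-- Entrywise derivative of a matrix-valued function of time. -/
def HasMatDerivAt {m n : Type*} (A : ℝ → Matrix m n ℝ) (A' : Matrix m n ℝ) (t : ℝ) : Prop :=
  ∀ i j, HasDerivAt (fun τ => A τ i j) (A' i j) t

/-! ### Gaussian process models -/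

/-- The squared exponential kernel. -/
def seKernel (sf : ℝ) (L : Matrix I6 I6 ℝ) (x x' : I6 → ℝ) : ℝ :=
  sf ^ 2 * Real.exp (-(1 / 2) * ((x - x') ⬝ᵥ (L *ᵥ (x - x'))))

/-- Hyperparameters and training inputs of a Gaussian process model with `M` data points. -/
structure GPModel (M : ℕ) where
  /-- signal standard deviation -/
  sf : ℝ
  /-- lengthscales matrix -/
  L : Matrix I6 I6 ℝ
  /-- noise standard deviation of each output -/
  sn : I6 → ℝ
  /-- training inputs -/
  inputs : Fin M → I6 → ℝ

namespace GPModel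

variable {M : ℕ} (gp : GPModel M)

/-- The kernel. -/
def k (x x' : I6 → ℝ) : ℝ := seKernel gp.sf gp.L x x'

/-- Gram matrix of a family of points. -/
def gramOf (A : Fin M → I6 → ℝ) : Matrix (Fin M) (Fin M) ℝ :=
  Matrix.of fun j j' => gp.k (A j) (A j')

/-- The vector of covariances between the training inputs and a test input. -/
def kvec (x : I6 → ℝ) : Fin M → ℝ := fun j => gp.k (gp.inputs j) x

/-- Gram matrix of the training inputs plus noise variance of output `i`. -/
def noisyGram (i : I6) : Matrix (Fin M) (Fin M) ℝ :=
  gp.gramOf gp.inputs + (gp.sn i ^ 2) • (1 : Matrix (Fin M) (Fin M) ℝ)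

/-- Posterior mean, given the training outputs `y`. -/
def mean (y : Fin M → I6 → ℝ) (x : I6 → ℝ) : I6 → ℝ :=
  fun i => gp.kvec x ⬝ᵥ ((gp.noisyGram i)⁻¹ *ᵥ fun j => y j i)

/-- Posterior variance of output `i`. -/
def var (x : I6 → ℝ) (i : I6) : ℝ :=
  gp.k x x - gp.kvec x ⬝ᵥ ((gp.noisyGram i)⁻¹ *ᵥ gp.kvec x)

/-- Maximum information gain of output `i` from `M` measurements at points of `X`. -/
def maxInfoGain (X : Set (I6 → ℝ)) (i : I6) : ℝ :=
  sSup {γ | ∃ A : Fin M → I6 → ℝ, (∀ j, A j ∈ X) ∧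
    γ = (1 / 2) * Real.log
      ((1 : Matrix (Fin M) (Fin M) ℝ) + (gp.sn i ^ 2)⁻¹ • gp.gramOf A).det}

/-- The confidence weights `β`, for RKHS norms `B i` of the outputs and parameter `δ`. -/
def beta (X : Set (I6 → ℝ)) (B : I6 → ℝ) (δ : ℝ) : I6 → ℝ :=
  fun i => √(2 * B i ^ 2 + 300 * gp.maxInfoGain X i * Real.log ((M + 1) / δ) ^ 3)

/-- The norm `‖βᵀ Σ^{1/2}(x)‖`, where `Σ(x)` is the diagonal matrix of posterior variances. -/
def betaSigma (β : I6 → ℝ) (x : I6 → ℝ) : ℝ :=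
  euc (β ᵥ* Matrix.diagonal fun i => √(gp.var x i))

end GPModel

/-! ### Control law and closed loop -/

/-- The gain matrix `diag(K_c, K_e)`. -/
def gain (Kc Ke : Matrix I6 I6 ℝ) : Matrix (I6 ⊕ I6) (I6 ⊕ I6) ℝ :=
  Matrix.fromBlocks Kc 0 0 Ke

/-- The output matrix `N`, depending on the control rotation error. -/
def outMat (R : Matrix (Fin 3) (Fin 3) ℝ) : Matrix (I6 ⊕ I6) (I6 ⊕ I6) ℝ :=
  Matrix.fromBlocks 1 0 (-AdRot Rᵀ) 1

/-- The smallest eigenvalue of `Nᵀ K N` over all control rotation errors. -/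
def lamK (Kc Ke : Matrix I6 I6 ℝ) : ℝ :=
  sInf {l | ∃ R : SO3, Module.End.HasEigenvalue (Matrix.toLin'
    ((outMat (R : Matrix (Fin 3) (Fin 3) ℝ))ᵀ * gain Kc Ke * outMat R)) l}

/-- The stacked error `e = (e_c, e_e)`. -/
def stackErr (gce gee : Pose) : I6 ⊕ I6 → ℝ := Sum.elim gce.errVec gee.errVec

/-- The control law `u = -K N e - [Ad_{R_ce}; I] Ad_{R_ee} μ`. -/
def control (Kc Ke : Matrix I6 I6 ℝ) (gce gee : Pose) (μ : I6 → ℝ) : I6 ⊕ I6 → ℝ :=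
  -(gain Kc Ke *ᵥ (outMat gce.R *ᵥ stackErr gce gee))
    - Sum.elim (AdRot gce.R *ᵥ (AdRot gee.R *ᵥ μ)) (AdRot gee.R *ᵥ μ)

/-- The storage function. -/
def storage (gce gee : Pose) : ℝ :=
  (1 / 2) * ((euc gce.pos ^ 2 + Matrix.trace (1 - gce.R))
    + (euc gee.pos ^ 2 + Matrix.trace (1 - gee.R)))

/-- The signals of the visual pursuit system. -/
structure Signals (Mbar : ℕ) where
  /-- switching signal -/
  s : ℝ → Fin Mbar
  /-- switching instants -/
  J : Set ℝ
  /-- target pose -/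
  gwo : ℝ → Pose
  /-- camera pose -/
  gwc : ℝ → Pose
  /-- estimate of the relative pose -/
  gbar : ℝ → Pose
  /-- camera body velocity -/
  Vwc : ℝ → I6 → ℝ

namespace Signals

variable {Mbar : ℕ} (q : Signals Mbar)

/-- True relative pose. -/
def gco (t : ℝ) : Pose := (q.gwc t).inv.mul (q.gwo t)

/-- Estimated target pose. -/
def gwoBar (t : ℝ) : Pose := (q.gwc t).mul (q.gbar t)

/-- Control error pose. -/
def gce (gd : Pose) (t : ℝ) : Pose := gd.inv.mul (q.gbar t)

/-- Estimation error pose. -/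
def gee (t : ℝ) : Pose := (q.gbar t).inv.mul (q.gco t)

/-- The stacked error. -/
def e (gd : Pose) (t : ℝ) : I6 ⊕ I6 → ℝ := stackErr (q.gce gd t) (q.gee t)

/-- The storage function along the signals. -/
def S (gd : Pose) (t : ℝ) : ℝ := storage (q.gce gd t) (q.gee t)

/-- The control input; the switching is known, so the mean of the active mode is used,
evaluated at the estimated target pose. -/
def u (gd : Pose) (Kc Ke : Matrix I6 I6 ℝ) (mean : Fin Mbar → (I6 → ℝ) → I6 → ℝ) (t : ℝ) :
    I6 ⊕ I6 → ℝ :=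
  control Kc Ke (q.gce gd t) (q.gee t) (mean (q.s t) (q.gwoBar t).vec)

end Signals

/-- The signals form a solution on `[0, ∞)` of the closed loop of target, camera, visual motion
observer and control law, for motion profiles `v` and posterior means `mean`. The target stays in
the field `D`, the position of its estimate in `W`, and both rotation errors stay below `π / 2`. -/
structure IsClosedLoop {Mbar : ℕ} (D W : Set (Fin 3 → ℝ)) (gd : Pose) (Kc Ke : Matrix I6 I6 ℝ)
    (v mean : Fin Mbar → (I6 → ℝ) → I6 → ℝ) (q : Signals Mbar) : Prop where
  /-- finitely many switches in finite time -/
  locallyFinite : ∀ T : ℝ, (q.J ∩ Set.Icc 0 T).Finite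
  locallyConst : ∀ t, 0 < t → t ∉ q.J → ∀ᶠ τ in 𝓝 t, q.s τ = q.s t
  cont_wo : ContinuousOn (fun t => (q.gwo t).homog) (Set.Ici 0)
  cont_wc : ContinuousOn (fun t => (q.gwc t).homog) (Set.Ici 0)
  cont_bar : ContinuousOn (fun t => (q.gbar t).homog) (Set.Ici 0)
  /-- target motion -/
  ode_wo : ∀ t, 0 < t → t ∉ q.J → HasMatDerivAt (fun τ => (q.gwo τ).homog)
    ((q.gwo t).homog * twistHat (v (q.s t) (q.gwo t).vec)) t
  /-- camera motion -/
  ode_wc : ∀ t, 0 < t → t ∉ q.J → HasMatDerivAt (fun τ => (q.gwc τ).homog)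
    ((q.gwc t).homog * twistHat (q.Vwc t)) t
  /-- visual motion observer -/
  ode_bar : ∀ t, 0 < t → t ∉ q.J → HasMatDerivAt (fun τ => (q.gbar τ).homog)
    (-(twistHat (q.Vwc t) * (q.gbar t).homog)
      - (q.gbar t).homog * twistHat (q.u gd Kc Ke mean t ∘ Sum.inr)) t
  /-- the control part of the input is realized by the camera velocity -/
  input_c : ∀ t, 0 < t → t ∉ q.J → q.u gd Kc Ke mean t ∘ Sum.inl = -(gd.inv.Ad *ᵥ q.Vwc t)
  target_mem : ∀ t, 0 ≤ t → (q.gwo t).pos ∈ D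
  estimate_mem : ∀ t, 0 ≤ t → (q.gwoBar t).pos ∈ W
  angle_ce : ∀ t, 0 ≤ t → ∃ ξ θ, IsAxisAngle (q.gce gd t).R ξ θ ∧ |θ| < Real.pi / 2
  angle_ee : ∀ t, 0 ≤ t → ∃ ξ θ, IsAxisAngle (q.gee t).R ξ θ ∧ |θ| < Real.pi / 2

/-! ### Lipschitz constants and the ellipse -/

/-- `Lp` and `Lθ` are Lipschitz constants of the profile `v` with respect to position and
axis-angle vector, on poses with positions in `W`. -/
def IsLipschitzPair (W : Set (Fin 3 → ℝ)) (v : (I6 → ℝ) → I6 → ℝ) (Lp Lθ : ℝ) : Prop :=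
  0 ≤ Lp ∧ 0 ≤ Lθ ∧ ∀ g h : Pose, g.pos ∈ W → h.pos ∈ W →
    euc (v g.vec - v h.vec) ≤
      Lp * euc (g.pos - h.pos) + Lθ * euc (axisAngle g.R - axisAngle h.R)

/-- The size `c(Σ) = ‖βᵀ Σ^{1/2}‖ / (2 lamt) + π Lθ / lamt`, where `bs = ‖βᵀ Σ^{1/2}‖`. -/
def ellipseSize (lamt Lθ bs : ℝ) : ℝ := 1 / (2 * lamt) * bs + Real.pi * Lθ / lamt

/-- The function `E` of the error poses whose sublevel set `E ≤ 0` is the ellipse. -/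
def ellipseE (lam lamt c : ℝ) (gce gee : Pose) : ℝ :=
  √(euc gce.errVec ^ 2 + lamt / lam * (euc gee.errVec - c) ^ 2) - √(lamt / lam) * c

/-- `r` bounds the storage function on the ellipse of size `c` (rotation errors at most `π / 2`):
the ellipse lies in the sublevel set `{S ≤ r}`. -/
def StorageBoundOnEllipse (lam lamt c r : ℝ) : Prop :=
  ∀ gce gee : Pose,
    (∃ ξ θ, IsAxisAngle gce.R ξ θ ∧ |θ| ≤ Real.pi / 2) →
    (∃ ξ θ, IsAxisAngle gee.R ξ θ ∧ |θ| ≤ Real.pi / 2) →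
    ellipseE lam lamt c gce gee ≤ 0 → storage gce gee ≤ r

end VisualPursuit

end

open VisualPursuit

/-! Dissipation. `S` is a storage function for rigid body motion, and the control law is built so
that along the closed loop `S' = -(N e)ᵀ K (N e) + e_eᵀ Ad_{R_ee} (V_wo - μ)`
(`control_power_balance`). The first term is at most `-λ_K ‖e‖²`. In the second, `Ad_{R_ee}` is an
isometry, and the model error splits into the change of `v` between target and estimate plus `v - μ`
at the estimate. Positions contribute `L_p ‖e_e‖`, which lowers `λ_K` to `λ̃`; rotations contribute
at most `2π L_θ`, as axis-angle vectors have length at most `π`. This gives `S' ≤ -λ_K Q` with `Q =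
‖e_c‖² + ρ ‖e_e‖² - 2 ρ c ‖e_e‖` and `ρ = λ̃ / λ_K`, which is positive outside the ellipse
(`exists_deriv_S_le_ellipseQuad`).

Confidence. The posterior mean is kernel ridge regression. Its squared error is at most the
posterior variance times `2 ‖f‖²` plus `2 / l` times the noise form `εᵀ (K + l)⁻¹ K ε`
(`sq_regression_error_le`). The test input does not occur in this form, so one event on the finitely
many noise values serves all inputs at once. In an eigenbasis of `K` the form is a sum of squared
sub-Gaussian variables with weights `d / (d + l)`, whose total is at most `log det (1 + K / l)`,
twice an information gain. As the inputs are fixed, a union bound over coordinates and over the six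
outputs suffices (`measureReal_quadratic_form_gt_le`).

Conclusions. For rotation angles below `π / 2`, `S` lies between `‖e‖² / 2` and `‖e‖²`. Ultimate
boundedness needs no event: `v` and `μ` are bounded because the kernel is, so the quadratic term
wins for large errors. For convergence, `E ≥ ε` forces `Q ≥ ε²`, which `S ≥ 0` allows only for a
bounded time; and compactness bounds `Q` away from zero outside `{S ≤ r + ε}` (`exists_margin`).
Switching does no harm because `S` is common to all models and continuous, so the decrease adds up
across switches (`le_max_of_deriv_le_neg`). -/

namespace VisualPursuit

/-! ### Euclidean norm of coordinate vectors -/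

section Euclidean

variable {ι : Type*} [Fintype ι]

theorem euc_sq (x : ι → ℝ) : euc x ^ 2 = x ⬝ᵥ x := by
  rw [euc, EuclideanSpace.real_norm_sq_eq]
  simp [dotProduct, sq]

theorem euc_nonneg (x : ι → ℝ) : 0 ≤ euc x := norm_nonneg _

theorem dotProduct_le_euc_mul (x y : ι → ℝ) : x ⬝ᵥ y ≤ euc x * euc y := by
  have h := real_inner_le_norm (WithLp.toLp 2 x) (WithLp.toLp 2 y)
  simpa [euc, EuclideanSpace.inner_eq_star_dotProduct, dotProduct_comm] using h

theorem euc_add_le (x y : ι → ℝ) : euc (x + y) ≤ euc x + euc y := by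
  simpa [euc] using norm_add_le (WithLp.toLp 2 x) (WithLp.toLp 2 y)

theorem euc_sub_le (x y : ι → ℝ) : euc (x - y) ≤ euc x + euc y := by
  simpa [euc] using norm_sub_le (WithLp.toLp 2 x) (WithLp.toLp 2 y)

theorem euc_smul (a : ℝ) (x : ι → ℝ) : euc (a • x) = |a| * euc x := by
  simp [euc, norm_smul]

theorem euc_le_sum_abs (x : ι → ℝ) : euc x ≤ ∑ i, |x i| := by
  refine le_of_sq_le_sq ?_ (Finset.sum_nonneg fun i _ => abs_nonneg _)
  rw [euc_sq]
  calc x ⬝ᵥ x = ∑ i, |x i| ^ 2 := by simp [dotProduct, sq]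
    _ ≤ _ := Finset.sum_sq_le_sq_sum_of_nonneg fun i _ => abs_nonneg _

end Euclidean

/-! ### Spectral form of the noise term and of the information gain -/

section Spectral

variable {n : Type*} [Fintype n] [DecidableEq n]

/-- Orthogonal diagonalization of a positive semidefinite real matrix. -/
theorem exists_diagonalization {K : Matrix n n ℝ} (hK : K.PosSemidef) :
    ∃ (U : Matrix n n ℝ) (d : n → ℝ), Uᵀ * U = 1 ∧ U * Uᵀ = 1 ∧ (∀ i, 0 ≤ d i) ∧
      K = U * diagonal d * Uᵀ := by
  have hU := hK.1.eigenvectorUnitary.2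
  rw [Matrix.mem_unitaryGroup_iff] at hU
  have hU' : (hK.1.eigenvectorUnitary : Matrix n n ℝ) *
      (hK.1.eigenvectorUnitary : Matrix n n ℝ)ᵀ = 1 := by
    simpa [star_eq_conjTranspose, conjTranspose_eq_transpose_of_trivial] using hU
  refine ⟨hK.1.eigenvectorUnitary, hK.1.eigenvalues, mul_eq_one_comm.1 hU', hU',
    hK.eigenvalues_nonneg, ?_⟩
  have h := hK.1.spectral_theorem
  simpa [Unitary.conjStarAlgAut_apply, star_eq_conjTranspose,
    conjTranspose_eq_transpose_of_trivial, Function.comp_def] using h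

variable {K U : Matrix n n ℝ} {d : n → ℝ} {l : ℝ}

theorem inv_add_smul_one_of_diagonalization (hU : Uᵀ * U = 1) (hU' : U * Uᵀ = 1)
    (hd : ∀ i, 0 ≤ d i) (hK : K = U * diagonal d * Uᵀ) (hl : 0 < l) :
    (K + l • (1 : Matrix n n ℝ))⁻¹ = U * diagonal (fun i => (d i + l)⁻¹) * Uᵀ := by
  apply Matrix.inv_eq_right_inv
  have h1 : K + l • (1 : Matrix n n ℝ) = U * diagonal (fun i => d i + l) * Uᵀ := by
    have : diagonal (fun i => d i + l) = diagonal d + l • (1 : Matrix n n ℝ) := by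
      ext i j
      by_cases h : i = j <;> simp [h]
    rw [this, Matrix.mul_add, Matrix.add_mul, ← hK]
    simp [hU']
  calc (K + l • (1 : Matrix n n ℝ)) * (U * diagonal (fun i => (d i + l)⁻¹) * Uᵀ)
      = U * diagonal (fun i => d i + l) * (Uᵀ * U) * diagonal (fun i => (d i + l)⁻¹) * Uᵀ := by
        rw [h1]; simp only [Matrix.mul_assoc]
    _ = 1 := by
        rw [hU, Matrix.mul_one, Matrix.mul_assoc U, diagonal_mul_diagonal]
        have : (fun i => (d i + l) * (d i + l)⁻¹) = fun _ => (1 : ℝ) :=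
          funext fun i => mul_inv_cancel₀ (by have := hd i; positivity)
        rw [this, diagonal_one, Matrix.mul_one, hU']

theorem dotProduct_inv_mulVec_of_diagonalization (hU : Uᵀ * U = 1) (hU' : U * Uᵀ = 1)
    (hd : ∀ i, 0 ≤ d i) (hK : K = U * diagonal d * Uᵀ) (hl : 0 < l) (x : n → ℝ) :
    ((K + l • (1 : Matrix n n ℝ))⁻¹ *ᵥ x) ⬝ᵥ (K *ᵥ x) =
      ∑ i, d i / (d i + l) * (Uᵀ *ᵥ x) i ^ 2 := by
  have h : ∀ (a b : n → ℝ), (U *ᵥ a) ⬝ᵥ (U *ᵥ b) = a ⬝ᵥ b := by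
    intro a b
    rw [dotProduct_mulVec, ← mulVec_transpose, mulVec_mulVec, hU, one_mulVec]
  rw [inv_add_smul_one_of_diagonalization hU hU' hd hK hl, hK]
  simp only [← mulVec_mulVec]
  rw [h]
  simp only [dotProduct, mulVec_diagonal]
  refine Finset.sum_congr rfl fun i _ => ?_
  field_simp

theorem log_det_of_diagonalization (hU' : U * Uᵀ = 1)
    (hd : ∀ i, 0 ≤ d i) (hK : K = U * diagonal d * Uᵀ) (hl : 0 < l) :
    Real.log ((1 : Matrix n n ℝ) + l⁻¹ • K).det = ∑ i, Real.log (1 + d i / l) := by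
  have h1 : (1 : Matrix n n ℝ) + l⁻¹ • K = U * diagonal (fun i => 1 + d i / l) * Uᵀ := by
    have : diagonal (fun i => 1 + d i / l) = (1 : Matrix n n ℝ) + l⁻¹ • diagonal d := by
      ext i j
      by_cases h : i = j <;> simp [h, div_eq_inv_mul]
    rw [this, Matrix.mul_add, Matrix.add_mul, hK]
    simp [hU']
  have h2 : U.det * Uᵀ.det = 1 := by rw [← det_mul, hU', det_one]
  rw [h1, det_mul, det_mul, mul_right_comm, h2, one_mul, det_diagonal, Real.log_prod]
  intro i _
  have := hd i
  positivity

/-- Termwise this is `1 - 1 / x ≤ log x` at `x = 1 + d / l`. The left side is the total weight of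
the squared noise coordinates. -/
theorem sum_div_le_log_det (hU' : U * Uᵀ = 1)
    (hd : ∀ i, 0 ≤ d i) (hK : K = U * diagonal d * Uᵀ) (hl : 0 < l) :
    ∑ i, d i / (d i + l) ≤ Real.log ((1 : Matrix n n ℝ) + l⁻¹ • K).det := by
  rw [log_det_of_diagonalization hU' hd hK hl]
  refine Finset.sum_le_sum fun i _ => ?_
  have := hd i
  have h := Real.one_sub_inv_le_log_of_pos (x := 1 + d i / l) (by positivity)
  refine le_trans (le_of_eq ?_) h
  field_simp
  ring

end Spectral

/-! ### Ridge regression in an inner product space -/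

section Regression

open scoped RealInnerProductSpace

variable {n : Type*} [Fintype n] [DecidableEq n]
variable {E : Type*} [NormedAddCommGroup E] [InnerProductSpace ℝ E]

/-- Kernel ridge regression error in feature space: `f` is the target, `φ` the features of
the inputs, `z` the feature of the test point and `ε` the measurement error. -/
theorem sq_regression_error_le (φ : n → E) (f z : E) {l : ℝ} (hl : 0 < l) (ε : n → ℝ)
    {A : Matrix n n ℝ} (hA : A = gram ℝ φ + l • (1 : Matrix n n ℝ)) (k : n → ℝ)
    (hk : ∀ j, k j = ⟪φ j, z⟫) :
    0 ≤ ⟪z, z⟫ - k ⬝ᵥ (A⁻¹ *ᵥ k) ∧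
    (⟪f, z⟫ - k ⬝ᵥ (A⁻¹ *ᵥ fun j => ⟪f, φ j⟫ + ε j)) ^ 2 ≤
      (⟪z, z⟫ - k ⬝ᵥ (A⁻¹ *ᵥ k)) *
        (2 * ‖f‖ ^ 2 + 2 * ((A⁻¹ *ᵥ ε) ⬝ᵥ (gram ℝ φ *ᵥ ε)) / l) := by
  have hKpsd : (gram ℝ φ).PosSemidef := posSemidef_gram ℝ φ
  have hApd : A.PosDef := by
    rw [hA]
    exact Matrix.PosDef.posSemidef_add hKpsd (Matrix.PosDef.one.smul hl)
  have hdet : IsUnit A.det := (Matrix.isUnit_iff_isUnit_det _).1 hApd.isUnit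
  have hAT : Aᵀ = A := by
    simpa [conjTranspose_eq_transpose_of_trivial] using hApd.1.eq
  have hKT : (gram ℝ φ)ᵀ = gram ℝ φ := by
    simpa [conjTranspose_eq_transpose_of_trivial] using hKpsd.1.eq
  set α := A⁻¹ *ᵥ k with hα
  set w := A⁻¹ *ᵥ ε with hw
  have hAα : gram ℝ φ *ᵥ α + l • α = k := by
    have : A *ᵥ α = k := by rw [hα, mulVec_mulVec, mul_nonsing_inv _ hdet, one_mulVec]
    rwa [hA, add_mulVec, smul_mulVec, one_mulVec] at this
  have hAw : gram ℝ φ *ᵥ w + l • w = ε := by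
    have : A *ᵥ w = ε := by rw [hw, mulVec_mulVec, mul_nonsing_inv _ hdet, one_mulVec]
    rwa [hA, add_mulVec, smul_mulVec, one_mulVec] at this
  have hswap : ∀ y : n → ℝ, k ⬝ᵥ (A⁻¹ *ᵥ y) = α ⬝ᵥ y := by
    intro y
    rw [hα, dotProduct_mulVec, ← mulVec_transpose, transpose_nonsing_inv, hAT]
  set u : (n → ℝ) → E := fun c => ∑ j, c j • φ j with hu
  have hinner : ∀ (y : E) (c : n → ℝ), ⟪y, u c⟫ = c ⬝ᵥ fun j => ⟪y, φ j⟫ := by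
    intro y c
    simp [hu, inner_sum, inner_smul_right, dotProduct]
  have hgram : ∀ c : n → ℝ, (fun j => ⟪u c, φ j⟫) = gram ℝ φ *ᵥ c := by
    intro c
    ext j
    simp [hu, sum_inner, inner_smul_left, mulVec, dotProduct, gram_apply]
    refine Finset.sum_congr rfl fun i _ => ?_
    rw [real_inner_comm]; ring
  have hzk : (fun j => ⟪z, φ j⟫) = k := funext fun j => by rw [hk, real_inner_comm]
  -- The residual of the test feature after ridge regression on the training features. Its inner
  -- products with these are `l • α`, so the posterior variance becomes `‖r‖² + l |α|²`.
  set r := z - u α with hr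
  have hrφ : (fun j => ⟪r, φ j⟫) = l • α := by
    have : (fun j => ⟪r, φ j⟫) = (fun j => ⟪z, φ j⟫) - fun j => ⟪u α, φ j⟫ := by
      ext j; simp [hr, inner_sub_left]
    rw [this, hzk, hgram, ← hAα]; simp
  have hvar : ⟪z, z⟫ - k ⬝ᵥ α = ‖r‖ ^ 2 + l * (α ⬝ᵥ α) := by
    have h1 : ‖r‖ ^ 2 = ⟪r, z⟫ - ⟪r, u α⟫ := by
      rw [← inner_sub_right, ← real_inner_self_eq_norm_sq]
    have h2 : ⟪r, u α⟫ = l * (α ⬝ᵥ α) := by rw [hinner, hrφ]; simp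
    have h3 : ⟪r, z⟫ = ⟪z, z⟫ - k ⬝ᵥ α := by
      rw [hr, inner_sub_left, real_inner_comm z (u α), hinner, hzk, dotProduct_comm]
    rw [h1, h2, h3]; ring
  have hαα : 0 ≤ α ⬝ᵥ α := by rw [← euc_sq]; positivity
  set b := gram ℝ φ *ᵥ w with hb
  -- The noise is split as `ε = K w + l w`. The part `l w` is absorbed into `f` as `u w`, so the two
  -- error terms pair with the two summands of the variance.
  have herr : ⟪f, z⟫ - k ⬝ᵥ (A⁻¹ *ᵥ fun j => ⟪f, φ j⟫ + ε j) = ⟪r, f - u w⟫ - α ⬝ᵥ b := by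
    have h1 : k ⬝ᵥ (A⁻¹ *ᵥ fun j => ⟪f, φ j⟫ + ε j) = ⟪f, u α⟫ + α ⬝ᵥ ε := by
      rw [hswap, hinner, ← dotProduct_add]; rfl
    have h2 : ⟪r, u w⟫ = l * (α ⬝ᵥ w) := by
      rw [hinner, hrφ, dotProduct_comm]; simp
    have h3 : α ⬝ᵥ ε = α ⬝ᵥ b + l * (α ⬝ᵥ w) := by
      conv_lhs => rw [← hAw]
      simp [dotProduct_add]
    have h4 : ⟪r, f⟫ = ⟪f, z⟫ - ⟪f, u α⟫ := by
      rw [real_inner_comm, hr, inner_sub_right]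
    rw [h1, inner_sub_right, h2, h3, h4]; ring
  have hwb : w ⬝ᵥ b = ‖u w‖ ^ 2 := by
    rw [← real_inner_self_eq_norm_sq, hinner, hgram]
  have hq : w ⬝ᵥ (gram ℝ φ *ᵥ ε) = b ⬝ᵥ b + l * ‖u w‖ ^ 2 := by
    rw [dotProduct_mulVec, ← mulVec_transpose, hKT, ← hb]
    conv_lhs => rw [← hAw]
    rw [dotProduct_add, dotProduct_smul, dotProduct_comm b w, hwb]; rfl
  refine ⟨by rw [hvar]; positivity, ?_⟩
  rw [herr, hvar, hq]
  have hcs1 : |⟪r, f - u w⟫| ≤ ‖r‖ * ‖f - u w‖ := abs_real_inner_le_norm _ _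
  have hcs2 : |α ⬝ᵥ b| ≤ euc α * euc b := by
    refine abs_le.2 ⟨?_, dotProduct_le_euc_mul _ _⟩
    have := dotProduct_le_euc_mul (-α) b
    have hn : euc (-α) = euc α := by simp [euc]
    rw [hn, neg_dotProduct] at this
    linarith
  have htri : ‖f - u w‖ ^ 2 ≤ 2 * ‖f‖ ^ 2 + 2 * ‖u w‖ ^ 2 := by
    have h := norm_sub_le f (u w)
    nlinarith [norm_nonneg (f - u w), norm_nonneg f, norm_nonneg (u w), sq_nonneg (‖f‖ - ‖u w‖)]
  rw [← euc_sq α, ← euc_sq b]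
  have hab : (⟪r, f - u w⟫ - α ⬝ᵥ b) ^ 2 ≤ (‖r‖ * ‖f - u w‖ + euc α * euc b) ^ 2 := by
    rw [← sq_abs]
    have := (abs_sub (⟪r, f - u w⟫) (α ⬝ᵥ b)).trans (add_le_add hcs1 hcs2)
    gcongr
  -- Cauchy–Schwarz for the pairs `(‖r‖, √l |α|)` and `(‖f - u w‖, |b| / √l)`.
  have hcs : (‖r‖ * ‖f - u w‖ + euc α * euc b) ^ 2 ≤
      (‖r‖ ^ 2 + l * euc α ^ 2) * (‖f - u w‖ ^ 2 + euc b ^ 2 / l) := by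
    have : (‖r‖ ^ 2 + l * euc α ^ 2) * (‖f - u w‖ ^ 2 + euc b ^ 2 / l) -
        (‖r‖ * ‖f - u w‖ + euc α * euc b) ^ 2 =
        (‖r‖ * euc b - l * euc α * ‖f - u w‖) ^ 2 / l := by
      field_simp; ring
    have h2 : 0 ≤ (‖r‖ * euc b - l * euc α * ‖f - u w‖) ^ 2 / l := by positivity
    linarith
  refine hab.trans (hcs.trans ?_)
  refine mul_le_mul_of_nonneg_left ?_ (by positivity)
  have h5 : 2 * (euc b ^ 2 + l * ‖u w‖ ^ 2) / l = 2 * (euc b ^ 2 / l) + 2 * ‖u w‖ ^ 2 := by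
    field_simp
  have h6 : 0 ≤ euc b ^ 2 / l := by positivity
  linarith

end Regression

/-! ### Tail bounds for sub-Gaussian noise -/

section Tail

variable {Ω : Type*} [MeasurableSpace Ω] {P : Measure Ω}

theorem measureReal_sq_gt_le [IsFiniteMeasure P] {X : Ω → ℝ} {l τ : ℝ} (hl : 0 < l) (hτ : 0 ≤ τ)
    (hX : HasSubgaussianMGF X l.toNNReal P) :
    P.real {ω | l * τ < X ω ^ 2} ≤ 2 * Real.exp (-τ / 2) := by
  have hsub : {ω | l * τ < X ω ^ 2} ⊆ {ω | √(l * τ) ≤ X ω} ∪ {ω | √(l * τ) ≤ (-X) ω} := by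
    intro ω hω
    have h : √(l * τ) ≤ |X ω| := by
      rw [← Real.sqrt_sq_eq_abs]
      exact Real.sqrt_le_sqrt (le_of_lt hω)
    rcases le_abs.1 h with h | h
    · exact Or.inl h
    · exact Or.inr h
  have hexp : Real.exp (-√(l * τ) ^ 2 / (2 * l.toNNReal)) = Real.exp (-τ / 2) := by
    rw [Real.sq_sqrt (by positivity), Real.coe_toNNReal _ hl.le]
    congr 1
    field_simp
  have h1 := hX.measure_ge_le (Real.sqrt_nonneg (l * τ))
  have h2 := hX.neg.measure_ge_le (Real.sqrt_nonneg (l * τ))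
  rw [hexp] at h1 h2
  calc _ ≤ _ := measureReal_mono hsub
    _ ≤ _ := measureReal_union_le _ _
    _ ≤ _ := by linarith

variable {n : Type*} [Fintype n]

/-- The squared coefficients sum to one, so the variance proxies average back to `l`: noise
coordinates in an orthonormal eigenbasis are as sub-Gaussian as the original ones. They may become
dependent, which a union bound tolerates. -/
theorem hasSubgaussianMGF_linear_combination {N : n → Ω → ℝ} {l : ℝ}
    (hind : iIndepFun N P) (hN : ∀ j, HasSubgaussianMGF (N j) l.toNNReal P)
    (a : n → ℝ) (ha : a ⬝ᵥ a = 1) :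
    HasSubgaussianMGF (fun ω => ∑ j, a j * N j ω) l.toNNReal P := by
  have hind' : iIndepFun (fun j ω => a j * N j ω) P :=
    hind.comp (fun j x => a j * x) fun j => measurable_const_mul (a j)
  have hsub : ∀ j, HasSubgaussianMGF (fun ω => a j * N j ω)
      ((a j ^ 2).toNNReal * l.toNNReal) P := fun j => by
    rw [Real.toNNReal_of_nonneg (sq_nonneg (a j))]
    exact (hN j).const_mul (a j)
  have h := HasSubgaussianMGF.sum_of_iIndepFun hind' (s := Finset.univ) fun j _ => hsub j
  rwa [← Finset.sum_mul, ← Real.toNNReal_sum_of_nonneg fun j _ => sq_nonneg (a j),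
    show ∑ j, a j ^ 2 = 1 by simpa [dotProduct, sq] using ha, Real.toNNReal_one, one_mul] at h

/-- Tail bound for the quadratic form `εᵀ (K + l)⁻¹ K ε` of independent sub-Gaussian noise. -/
theorem measureReal_quadratic_form_gt_le [IsFiniteMeasure P] [DecidableEq n] {N : n → Ω → ℝ} {l τ : ℝ} (hl : 0 < l) (hτ : 0 ≤ τ)
    (hind : iIndepFun N P) (hN : ∀ j, HasSubgaussianMGF (N j) l.toNNReal P)
    {K : Matrix n n ℝ} (hK : K.PosSemidef) :
    P.real {ω | l * τ * Real.log ((1 : Matrix n n ℝ) + l⁻¹ • K).det <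
      ((K + l • (1 : Matrix n n ℝ))⁻¹ *ᵥ fun j => N j ω) ⬝ᵥ (K *ᵥ fun j => N j ω)} ≤
      Fintype.card n * (2 * Real.exp (-τ / 2)) := by
  obtain ⟨U, d, hU, hU', hd, hKU⟩ := exists_diagonalization hK
  have hsub : {ω | l * τ * Real.log ((1 : Matrix n n ℝ) + l⁻¹ • K).det <
      ((K + l • (1 : Matrix n n ℝ))⁻¹ *ᵥ fun j => N j ω) ⬝ᵥ (K *ᵥ fun j => N j ω)} ⊆
      -- If every eigencoordinate has square at most `l τ`, the form is at most `l τ` times the sum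
      -- of the weights.
      ⋃ i, {ω | l * τ < (∑ j, U j i * N j ω) ^ 2} := by
    intro ω hω
    by_contra hcon
    simp only [Set.mem_iUnion, Set.mem_ofPred_eq, not_exists, not_lt] at hcon hω
    rw [dotProduct_inv_mulVec_of_diagonalization hU hU' hd hKU hl] at hω
    refine absurd hω (not_lt.2 ?_)
    calc ∑ i, d i / (d i + l) * (Uᵀ *ᵥ fun j => N j ω) i ^ 2
        ≤ ∑ i, d i / (d i + l) * (l * τ) := by
          refine Finset.sum_le_sum fun i _ => ?_
          have := hd i
          refine mul_le_mul_of_nonneg_left ?_ (by positivity)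
          simpa [mulVec, dotProduct] using hcon i
      _ = l * τ * ∑ i, d i / (d i + l) := by rw [← Finset.sum_mul, mul_comm]
      _ ≤ _ := mul_le_mul_of_nonneg_left (sum_div_le_log_det hU' hd hKU hl) (by positivity)
  calc _ ≤ _ := measureReal_mono hsub
    _ ≤ ∑ i, P.real {ω | l * τ < (∑ j, U j i * N j ω) ^ 2} := measureReal_iUnion_fintype_le _
    _ ≤ ∑ _i : n, 2 * Real.exp (-τ / 2) := by
      refine Finset.sum_le_sum fun i _ => measureReal_sq_gt_le hl hτ ?_
      refine hasSubgaussianMGF_linear_combination hind hN (fun j => U j i) ?_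
      have := congrFun (congrFun hU i) i
      simpa [Matrix.mul_apply, dotProduct] using this
    _ = _ := by simp

end Tail

/-- The weights of the confidence bound dominate the quantile of the noise. -/
theorem log_quantile_le {M : ℕ} (hM : 0 < M) {δ : ℝ} (hδ0 : 0 < δ) (hδ1 : δ < 1) :
    0 ≤ Real.log (12 * M / δ ^ 6) ∧
      8 * Real.log (12 * M / δ ^ 6) ≤ 300 * Real.log ((M + 1) / δ) ^ 3 := by
  have hM1 : (1 : ℝ) ≤ M := by exact_mod_cast hM
  have hx : 0 < -Real.log δ := by have := Real.log_neg hδ0 hδ1; linarith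
  have hMlog : 0 ≤ Real.log M := Real.log_nonneg hM1
  have hm : Real.log M ≤ Real.log (M + 1) := Real.log_le_log (by linarith) (by linarith)
  have hm2 : Real.log 2 ≤ Real.log (M + 1) := Real.log_le_log (by norm_num) (by linarith)
  have hl2 : (0.69 : ℝ) < Real.log 2 := by linarith [Real.log_two_gt_d9]
  have hl2' : Real.log 2 < 0.7 := by linarith [Real.log_two_lt_d9]
  have h12 : Real.log 12 ≤ 2.8 := by
    have h16 : Real.log 16 = 4 * Real.log 2 := by
      rw [show (16 : ℝ) = 2 ^ 4 by norm_num, Real.log_pow]; norm_num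
    have : Real.log 12 ≤ Real.log 16 := Real.log_le_log (by norm_num) (by norm_num)
    linarith
  have h12' : 0 ≤ Real.log 12 := Real.log_nonneg (by norm_num)
  have e1 : Real.log (12 * M / δ ^ 6) = Real.log 12 + Real.log M + 6 * (-Real.log δ) := by
    rw [Real.log_div (by positivity) (by positivity), Real.log_mul (by norm_num) (by positivity),
      Real.log_pow]
    push_cast; ring
  have e2 : Real.log ((M + 1) / δ) = Real.log (M + 1) + -Real.log δ := by
    rw [Real.log_div (by positivity) (by positivity)]; ring
  set y := Real.log ((M + 1) / δ) with hy
  refine ⟨by rw [e1]; positivity, ?_⟩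
  have hy1 : 0.69 ≤ y := by linarith
  have h3 : 0 ≤ y * (3 * y ^ 2 - 1) := mul_nonneg (by linarith) (by nlinarith)
  rw [e1]
  -- The left side is at most `100 y`, since `log 12 ≤ 2.8` and `y ≥ 0.69`; and `3 y² ≥ 1` turns
  -- `100 y` into `300 y³`.
  linarith [show 300 * y ^ 3 - 100 * y = 100 * (y * (3 * y ^ 2 - 1)) by ring]

theorem poseVecs_mono {D W : Set (Fin 3 → ℝ)} (h : D ⊆ W) : poseVecs D ⊆ poseVecs W := by
  rintro x ⟨g, hg, rfl⟩
  exact ⟨g, h hg, rfl⟩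

theorem Pose.vec_mem_poseVecs {W : Set (Fin 3 → ℝ)} {g : Pose} (h : g.pos ∈ W) :
    g.vec ∈ poseVecs W := ⟨g, h, rfl⟩

/-! ### Confidence bounds for Gaussian process models -/

namespace GPModel

open scoped RealInnerProductSpace

variable {M : ℕ} (gp : GPModel M)

theorem k_self (x : I6 → ℝ) : gp.k x x = gp.sf ^ 2 := by simp [k, seKernel]

variable {gp}

theorem abs_k_le (hL : gp.L.PosSemidef) (x y : I6 → ℝ) : |gp.k x y| ≤ gp.sf ^ 2 := by
  have h : 0 ≤ (x - y) ⬝ᵥ (gp.L *ᵥ (x - y)) := by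
    simpa using hL.dotProduct_mulVec_nonneg (x - y)
  have h2 : Real.exp (-(1 / 2) * ((x - y) ⬝ᵥ (gp.L *ᵥ (x - y)))) ≤ 1 :=
    Real.exp_le_one_iff.2 (by linarith)
  rw [k, seKernel, abs_of_nonneg (by positivity)]
  nlinarith [sq_nonneg gp.sf]

/-- The data enter only through fixed weights of bounded kernel functions. The bound holds for every
data set, which is what boundedness for every outcome of the noise requires. -/
theorem exists_abs_mean_le (hL : gp.L.PosSemidef) (y : Fin M → I6 → ℝ) :
    ∃ C, ∀ x i, |gp.mean y x i| ≤ C := by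
  refine ⟨∑ i, ∑ j, gp.sf ^ 2 * |((gp.noisyGram i)⁻¹ *ᵥ fun j => y j i) j|, fun x i => ?_⟩
  have h1 : |gp.mean y x i| ≤ ∑ j, gp.sf ^ 2 * |((gp.noisyGram i)⁻¹ *ᵥ fun j => y j i) j| := by
    rw [mean, dotProduct]
    refine (Finset.abs_sum_le_sum_abs _ _).trans (Finset.sum_le_sum fun j _ => ?_)
    rw [abs_mul]
    exact mul_le_mul_of_nonneg_right (abs_k_le hL _ _) (abs_nonneg _)
  refine h1.trans (Finset.single_le_sum (f := fun i => ∑ j, gp.sf ^ 2 *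
    |((gp.noisyGram i)⁻¹ *ᵥ fun j => y j i) j|) 
    (fun i _ => Finset.sum_nonneg fun j _ => by positivity) (Finset.mem_univ i))

/-- The point is that the supremum is over a bounded set: the matrix entries are bounded uniformly
in the points, hence so is the determinant. -/
theorem half_log_det_le_maxInfoGain (hL : gp.L.PosSemidef) {X : Set (I6 → ℝ)}
    (hX : ∀ j, gp.inputs j ∈ X) (i : I6) :
    (1 / 2) * Real.log
      ((1 : Matrix (Fin M) (Fin M) ℝ) + (gp.sn i ^ 2)⁻¹ • gp.gramOf gp.inputs).det ≤
      gp.maxInfoGain X i := by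
  refine le_csSup ?_ ⟨gp.inputs, hX, rfl⟩
  set B : ℝ := 1 + (gp.sn i ^ 2)⁻¹ * gp.sf ^ 2
  refine ⟨(1 / 2) * ((Fintype.card (Fin M)).factorial • B ^ Fintype.card (Fin M)), ?_⟩
  rintro γ ⟨A, -, rfl⟩
  have hdet := Matrix.det_le (abv := AbsoluteValue.abs) (x := B)
    (A := (1 : Matrix (Fin M) (Fin M) ℝ) + (gp.sn i ^ 2)⁻¹ • gp.gramOf A) (by
      intro a b
      have h1 : |(1 : Matrix (Fin M) (Fin M) ℝ) a b| ≤ 1 := by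
        rw [Matrix.one_apply]; split_ifs <;> simp
      have h2 : |(gp.sn i ^ 2)⁻¹ * gp.k (A a) (A b)| ≤ (gp.sn i ^ 2)⁻¹ * gp.sf ^ 2 := by
        rw [abs_mul, abs_of_nonneg (by positivity : (0:ℝ) ≤ (gp.sn i ^ 2)⁻¹)]
        exact mul_le_mul_of_nonneg_left (abs_k_le hL _ _) (by positivity)
      exact (abs_add_le _ _).trans (add_le_add h1 h2))
  have hlog : ∀ x : ℝ, Real.log x ≤ |x| := fun x => by
    rw [← Real.log_abs]; exact Real.log_le_self (abs_nonneg x)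
  have := (hlog _).trans hdet
  linarith

section RKHS

variable {X : Set (I6 → ℝ)} {H : Type*} [NormedAddCommGroup H] [InnerProductSpace ℝ H]
  [CompleteSpace H] [RKHS ℝ H X ℝ]

theorem inner_kerFun_kerFun (hH : ∀ x y : X, RKHS.kernel H x y 1 = gp.k x y) (x y : X) :
    ⟪RKHS.kerFun H x 1, RKHS.kerFun H y 1⟫ = gp.k x y := by
  rw [real_inner_comm, ← RKHS.kernel_inner, hH]
  simp

theorem abs_apply_le (hsf : 0 < gp.sf) (hH : ∀ x y : X, RKHS.kernel H x y 1 = gp.k x y)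
    (f : H) (x : X) : |f x| ≤ ‖f‖ * gp.sf := by
  have h1 : f x = ⟪f, RKHS.kerFun H x 1⟫ := by simp
  have h2 : ‖RKHS.kerFun H x 1‖ = gp.sf := by
    rw [← sq_eq_sq₀ (norm_nonneg _) hsf.le, ← real_inner_self_eq_norm_sq,
      inner_kerFun_kerFun hH, k_self]
  rw [h1, ← h2]
  exact abs_real_inner_le_norm _ _

variable (hH : ∀ x y : X, RKHS.kernel H x y 1 = gp.k x y) (hin : ∀ j, gp.inputs j ∈ X)
include hH hin

theorem gram_kerFun : gram ℝ (fun j => RKHS.kerFun H (⟨gp.inputs j, hin j⟩ : X) 1) =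
    gp.gramOf gp.inputs := by
  ext i j
  rw [gram_apply, inner_kerFun_kerFun hH]
  rfl

/-- Positivity of the squared exponential kernel is not computed; it is inherited from the RKHS,
where the matrix is a Gram matrix of kernel functions. -/
theorem posSemidef_gramOf_inputs : (gp.gramOf gp.inputs).PosSemidef := by
  rw [← gram_kerFun hH hin]
  exact posSemidef_gram ℝ _

/-- Ridge regression with kernel functions as features; the reproducing property turns inner
products into function values. -/
theorem sq_error_le {i : I6} (hsn : 0 < gp.sn i) (f : H) (ε : Fin M → ℝ) (x : X) :
    0 ≤ gp.var x i ∧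
    (f x - gp.kvec x ⬝ᵥ ((gp.noisyGram i)⁻¹ *ᵥ fun j => f ⟨gp.inputs j, hin j⟩ + ε j)) ^ 2 ≤
      gp.var x i * (2 * ‖f‖ ^ 2 + 2 * (((gp.noisyGram i)⁻¹ *ᵥ ε) ⬝ᵥ
        (gp.gramOf gp.inputs *ᵥ ε)) / gp.sn i ^ 2) := by
  have h := sq_regression_error_le (fun j => RKHS.kerFun H (⟨gp.inputs j, hin j⟩ : X) 1) f
    (RKHS.kerFun H x 1) (pow_pos hsn 2) ε (A := gp.noisyGram i)
    (by rw [gram_kerFun hH hin]; rfl) (gp.kvec x)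
    (fun j => by rw [inner_kerFun_kerFun hH]; rfl)
  rw [inner_kerFun_kerFun hH, gram_kerFun hH hin] at h
  simpa [var] using h

theorem var_le {i : I6} (hsn : 0 < gp.sn i) (x : I6 → ℝ) : gp.var x i ≤ gp.sf ^ 2 := by
  have hpd : (gp.noisyGram i).PosDef :=
    Matrix.PosDef.posSemidef_add (posSemidef_gramOf_inputs hH hin)
      (Matrix.PosDef.one.smul (pow_pos hsn 2))
  have h : 0 ≤ gp.kvec x ⬝ᵥ ((gp.noisyGram i)⁻¹ *ᵥ gp.kvec x) := by
    simpa using hpd.inv.posSemidef.dotProduct_mulVec_nonneg (gp.kvec x)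
  rw [var, k_self]
  linarith

end RKHS

/-- The noise is small enough for the confidence bound on output `i`. -/
def NoiseBound (gp : GPModel M) (X : Set (I6 → ℝ)) (δ : ℝ) (i : I6) (ε : Fin M → ℝ) : Prop :=
  2 * (((gp.noisyGram i)⁻¹ *ᵥ ε) ⬝ᵥ (gp.gramOf gp.inputs *ᵥ ε)) / gp.sn i ^ 2 ≤
    300 * gp.maxInfoGain X i * Real.log ((M + 1) / δ) ^ 3

theorem measurableSet_noiseBound {Ω : Type*} [MeasurableSpace Ω] {N : Fin M → Ω → ℝ}
    (hN : ∀ j, Measurable (N j)) (X : Set (I6 → ℝ)) (δ : ℝ) (i : I6) :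
    MeasurableSet {ω | gp.NoiseBound X δ i fun j => N j ω} := by
  unfold NoiseBound
  refine measurableSet_le ?_ measurable_const
  simp only [dotProduct, mulVec]
  fun_prop

theorem measureReal_not_noiseBound_le {Ω : Type*} [MeasurableSpace Ω] {P : Measure Ω}
    [IsProbabilityMeasure P] {N : Fin M → Ω → ℝ} {i : I6} (hind : iIndepFun N P)
    (hN : ∀ j, HasSubgaussianMGF (N j) ((gp.sn i ^ 2).toNNReal) P) (hL : gp.L.PosSemidef)
    (hsn : 0 < gp.sn i) (hK : (gp.gramOf gp.inputs).PosSemidef) {X : Set (I6 → ℝ)}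
    (hX : ∀ j, gp.inputs j ∈ X) {δ : ℝ} (hδ0 : 0 < δ) (hδ1 : δ < 1) :
    P.real {ω | ¬ gp.NoiseBound X δ i fun j => N j ω} ≤ δ ^ 6 / 6 := by
  have hgain := half_log_det_le_maxInfoGain hL hX i
  -- Without data the noise form is an empty sum and the bad event is empty; the quantile below
  -- needs `M > 0`.
  rcases Nat.eq_zero_or_pos M with rfl | hM
  · have : {ω | ¬ gp.NoiseBound X δ i fun j => N j ω} = ∅ := by
      rw [Set.eq_empty_iff_forall_notMem]
      intro ω hω
      refine hω ?_
      simp only [det_isEmpty, Real.log_one, mul_zero] at hgain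
      have hlog : 0 ≤ Real.log (((0 : ℕ) + 1) / δ) :=
        Real.log_nonneg (by rw [le_div_iff₀ hδ0]; simpa using hδ1.le)
      simp only [NoiseBound, dotProduct, Finset.univ_eq_empty, Finset.sum_empty, mul_zero,
        zero_div]
      positivity
    rw [this, measureReal_empty]
    positivity
  obtain ⟨hτ, hτ'⟩ := log_quantile_le hM hδ0 hδ1
  set τ := Real.log (12 * M / δ ^ 6) with hτdef
  have hM1 : (1 : ℝ) ≤ M := by exact_mod_cast hM
  -- At level `2 τ` the tail is `M * 2 exp (-τ)`, and `τ` is chosen to make this `δ ^ 6 / 6`, the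
  -- share of one of six outputs.
  have htail := measureReal_quadratic_form_gt_le (pow_pos hsn 2) (mul_nonneg zero_le_two hτ)
    hind hN hK
  have hexp : (Fintype.card (Fin M) : ℝ) * (2 * Real.exp (-(2 * τ) / 2)) = δ ^ 6 / 6 := by
    rw [show -(2 * τ) / 2 = -τ by ring, Real.exp_neg, hτdef, Real.exp_log (by positivity),
      Fintype.card_fin]
    field_simp
    norm_num
  rw [hexp] at htail
  refine le_trans (measureReal_mono ?_) htail
  intro ω hω
  simp only [NoiseBound, Set.mem_ofPred_eq, not_le] at hω ⊢
  refine lt_of_not_ge fun hle => absurd hω (not_lt.2 ?_)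
  obtain ⟨U, d, -, hU', hd, hKU⟩ := exists_diagonalization hK
  have hld : 0 ≤ Real.log
      ((1 : Matrix (Fin M) (Fin M) ℝ) + (gp.sn i ^ 2)⁻¹ • gp.gramOf gp.inputs).det :=
    le_trans (Finset.sum_nonneg fun j _ => by have := hd j; positivity)
      (sum_div_le_log_det hU' hd hKU (pow_pos hsn 2))
  set ld := Real.log
      ((1 : Matrix (Fin M) (Fin M) ℝ) + (gp.sn i ^ 2)⁻¹ • gp.gramOf gp.inputs).det
  have hsn2 := pow_pos hsn 2
  rw [div_le_iff₀ hsn2]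
  calc _ ≤ 2 * (gp.sn i ^ 2 * (2 * τ) * ld) := mul_le_mul_of_nonneg_left hle zero_le_two
    _ = (8 * τ) * ((1 / 2) * ld) * gp.sn i ^ 2 := by ring
    _ ≤ (300 * Real.log ((M + 1) / δ) ^ 3) * gp.maxInfoGain X i * gp.sn i ^ 2 := by
      refine mul_le_mul_of_nonneg_right (mul_le_mul hτ' hgain (by positivity) ?_) hsn2.le
      exact le_trans (by positivity) hτ'
    _ = _ := by ring

theorem betaSigma_nonneg (β x : I6 → ℝ) : 0 ≤ gp.betaSigma β x := euc_nonneg _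

/-- On the event of small noise the posterior mean stays within the confidence ellipsoid. -/
theorem euc_error_le_betaSigma {X Y : Set (I6 → ℝ)} {H : Type*} [NormedAddCommGroup H]
    [InnerProductSpace ℝ H] [CompleteSpace H] [RKHS ℝ H X ℝ]
    (hH : ∀ x y : X, RKHS.kernel H x y 1 = gp.k x y) (hin : ∀ j, gp.inputs j ∈ X)
    (hsn : ∀ i, 0 < gp.sn i) {v : (I6 → ℝ) → I6 → ℝ} (V : I6 → H)
    (hV : ∀ i (x : X), V i x = v x i) {δ : ℝ} (ε : Fin M → I6 → ℝ)
    (hε : ∀ i, gp.NoiseBound Y δ i fun j => ε j i) {x : I6 → ℝ} (hx : x ∈ X) :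
    euc (v x - gp.mean (fun j i => v (gp.inputs j) i + ε j i) x) ≤
      gp.betaSigma (gp.beta Y (fun i => ‖V i‖) δ) x := by
  refine le_of_sq_le_sq ?_ (betaSigma_nonneg _ _)
  rw [betaSigma, euc_sq, euc_sq]
  refine Finset.sum_le_sum fun i _ => ?_
  obtain ⟨hvar, h⟩ := sq_error_le hH hin (hsn i) (V i) (fun j => ε j i) ⟨x, hx⟩
  simp only [hV] at h
  rw [← sq, ← sq, vecMul_diagonal, mul_pow, Real.sq_sqrt hvar, mul_comm, beta,
    Real.sq_sqrt]
  · refine h.trans (mul_le_mul_of_nonneg_left ?_ hvar)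
    have := hε i
    unfold NoiseBound at this
    linarith
  -- The radicand in `beta` must be nonnegative for its square root to square back; on the event it
  -- dominates a positive semidefinite form.
  · have h0 : 0 ≤ ((gp.noisyGram i)⁻¹ *ᵥ fun j => ε j i) ⬝ᵥ
        (gp.gramOf gp.inputs *ᵥ fun j => ε j i) := by
      obtain ⟨U, d, hU, hU', hd, hKU⟩ :=
        exists_diagonalization (posSemidef_gramOf_inputs hH hin)
      rw [noisyGram, dotProduct_inv_mulVec_of_diagonalization hU hU' hd hKU (pow_pos (hsn i) 2)]
      exact Finset.sum_nonneg fun j _ => by have := hd j; have := pow_pos (hsn i) 2; positivity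
    have h1 := hε i
    unfold NoiseBound at h1
    have h2 := pow_pos (hsn i) 2
    have h3 : 0 ≤ 2 * (((gp.noisyGram i)⁻¹ *ᵥ fun j => ε j i) ⬝ᵥ
        (gp.gramOf gp.inputs *ᵥ fun j => ε j i)) / gp.sn i ^ 2 := by positivity
    nlinarith [sq_nonneg ‖V i‖]

/-- Posterior variances never exceed the prior variance. The bound is uniform in `x`, so the
supremum of the ellipse sizes is finite even for unbounded `W`. -/
theorem betaSigma_le {X : Set (I6 → ℝ)} {H : Type*} [NormedAddCommGroup H]
    [InnerProductSpace ℝ H] [CompleteSpace H] [RKHS ℝ H X ℝ] (hsf : 0 < gp.sf)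
    (hH : ∀ x y : X, RKHS.kernel H x y 1 = gp.k x y) (hin : ∀ j, gp.inputs j ∈ X)
    (hsn : ∀ i, 0 < gp.sn i) (β x : I6 → ℝ) :
    gp.betaSigma β x ≤ ∑ i, |β i| * gp.sf := by
  refine (euc_le_sum_abs _).trans (Finset.sum_le_sum fun i _ => ?_)
  rw [vecMul_diagonal, abs_mul, abs_of_nonneg (Real.sqrt_nonneg _)]
  refine mul_le_mul_of_nonneg_left ?_ (abs_nonneg _)
  exact Real.sqrt_le_iff.2 ⟨hsf.le, var_le hH hin (hsn i) x⟩

end GPModel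

/-! ### Isometries, operator bounds and Rayleigh quotients -/

section Norms

variable {ι κ : Type*} [Fintype ι] [Fintype κ]

theorem euc_sumElim_sq (a : ι → ℝ) (b : κ → ℝ) :
    euc (Sum.elim a b) ^ 2 = euc a ^ 2 + euc b ^ 2 := by
  simp [euc_sq, dotProduct]

theorem euc_mulVec_of_transpose_mul_self [DecidableEq ι] {A : Matrix ι ι ℝ} (hA : Aᵀ * A = 1)
    (x : ι → ℝ) : euc (A *ᵥ x) = euc x := by
  rw [← sq_eq_sq₀ (euc_nonneg _) (euc_nonneg _), euc_sq, euc_sq, dotProduct_mulVec,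
    ← mulVec_transpose, mulVec_mulVec, hA, one_mulVec]

theorem exists_euc_mulVec_le [DecidableEq ι] (A : Matrix ι ι ℝ) :
    ∃ C ≥ 0, ∀ x, euc (A *ᵥ x) ≤ C * euc x := by
  refine ⟨‖Matrix.toEuclideanCLM (𝕜 := ℝ) A‖, norm_nonneg _, fun x => ?_⟩
  have h := (Matrix.toEuclideanCLM (𝕜 := ℝ) A).le_opNorm (WithLp.toLp 2 x)
  simpa [euc] using h

theorem mul_dotProduct_self_le_of_le_eigenvalues [DecidableEq ι] {A : Matrix ι ι ℝ}
    (hA : A.IsHermitian) {m : ℝ}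
    (hm : ∀ l, Module.End.HasEigenvalue (Matrix.toLin' A) l → m ≤ l) (x : ι → ℝ) :
    m * (x ⬝ᵥ x) ≤ x ⬝ᵥ (A *ᵥ x) := by
  have hU := hA.eigenvectorUnitary.2
  rw [Matrix.mem_unitaryGroup_iff] at hU
  obtain ⟨U, hUdef⟩ : ∃ U : Matrix ι ι ℝ, U = hA.eigenvectorUnitary := ⟨_, rfl⟩
  have hU' : U * Uᵀ = 1 := by
    simpa [hUdef, star_eq_conjTranspose, conjTranspose_eq_transpose_of_trivial] using hU
  have hAU : A = U * diagonal hA.eigenvalues * Uᵀ := by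
    simpa [hUdef, Unitary.conjStarAlgAut_apply, star_eq_conjTranspose,
      conjTranspose_eq_transpose_of_trivial, Function.comp_def] using hA.spectral_theorem
  have heig : ∀ i, m ≤ hA.eigenvalues i := by
    intro i
    apply hm
    refine Module.End.hasEigenvalue_of_hasEigenvector
      (x := (WithLp.ofLp (hA.eigenvectorBasis i))) ⟨?_, ?_⟩
    · rw [Module.End.mem_eigenspace_iff, Matrix.toLin'_apply]
      exact hA.mulVec_eigenvectorBasis i
    · intro h
      have h1 := hA.eigenvectorBasis.orthonormal.1 i
      have h2 : hA.eigenvectorBasis i = 0 := by ext j; exact congrFun h j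
      rw [h2, norm_zero] at h1
      exact zero_ne_one h1
  have h1 : x ⬝ᵥ x = (Uᵀ *ᵥ x) ⬝ᵥ (Uᵀ *ᵥ x) := by
    rw [dotProduct_mulVec (Uᵀ *ᵥ x), vecMul_transpose, mulVec_mulVec, hU', one_mulVec]
  have h2 : x ⬝ᵥ (A *ᵥ x) = (Uᵀ *ᵥ x) ⬝ᵥ (diagonal hA.eigenvalues *ᵥ (Uᵀ *ᵥ x)) := by
    conv_lhs => rw [hAU]
    rw [← mulVec_mulVec, ← mulVec_mulVec, dotProduct_mulVec, ← mulVec_transpose]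
  rw [h1, h2, dotProduct, dotProduct, Finset.mul_sum]
  refine Finset.sum_le_sum fun i _ => ?_
  rw [mulVec_diagonal]
  nlinarith [heig i, mul_self_nonneg ((Uᵀ *ᵥ x) i)]

end Norms

/-! ### Poses -/

theorem hat_transpose (a : Fin 3 → ℝ) : (hat a)ᵀ = -hat a := by
  ext i j
  fin_cases i <;> fin_cases j <;> simp [hat]

/-- Before orthogonality is used, `Rᵀ (R w)^ R = det R • ŵ` is a polynomial identity valid for every
matrix. -/
theorem hat_conj {R : Matrix (Fin 3) (Fin 3) ℝ} (hR : R * Rᵀ = 1) (hdet : R.det = 1)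
    (w : Fin 3 → ℝ) : R * hat w = hat (R *ᵥ w) * R := by
  have key : Rᵀ * (hat (R *ᵥ w) * R) = R.det • hat w := by
    rw [Matrix.det_fin_three]
    ext i j
    simp only [Matrix.mul_apply, Fin.sum_univ_three, transpose_apply, Matrix.smul_apply]
    fin_cases i <;> fin_cases j <;>
      simp [hat, Fin.sum_univ_three, mulVec, dotProduct] <;> ring
  calc R * hat w = R * (R.det • hat w) := by rw [hdet, one_smul]
    _ = R * Rᵀ * (hat (R *ᵥ w) * R) := by rw [← key, Matrix.mul_assoc]
    _ = _ := by rw [hR, Matrix.one_mul]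

namespace Pose

theorem R_mul_transpose (g : Pose) : g.R * g.Rᵀ = 1 := by
  have h := (Matrix.mem_orthogonalGroup_iff (Fin 3) ℝ).1
    (Matrix.mem_specialOrthogonalGroup_iff.1 g.rot.2).1
  exact h

theorem R_transpose_mul (g : Pose) : g.Rᵀ * g.R = 1 := mul_eq_one_comm.1 g.R_mul_transpose

theorem det_R (g : Pose) : g.R.det = 1 := (Matrix.mem_specialOrthogonalGroup_iff.1 g.rot.2).2

theorem R_mul (g h : Pose) : (g.mul h).R = g.R * h.R := rfl

theorem R_inv (g : Pose) : g.inv.R = g.Rᵀ := by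
  have h1 : g.inv.R * g.R = 1 := by
    have : g.inv.rot * g.rot = 1 := inv_mul_cancel g.rot
    exact congrArg Subtype.val this
  calc g.inv.R = g.inv.R * (g.R * g.Rᵀ) := by rw [R_mul_transpose, Matrix.mul_one]
    _ = g.Rᵀ := by rw [← Matrix.mul_assoc, h1, Matrix.one_mul]

theorem homog_inl_inr (g : Pose) (i : Fin 3) (j : Unit) :
    g.homog (Sum.inl i) (Sum.inr j) = g.pos i := rfl

theorem homog_inl_inl (g : Pose) (i j : Fin 3) :
    g.homog (Sum.inl i) (Sum.inl j) = g.R i j := rfl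

theorem homog_injective {g h : Pose} (H : g.homog = h.homog) : g = h := by
  apply Pose.ext
  · ext i
    exact congrFun (congrFun H (Sum.inl i)) (Sum.inr ())
  · apply Subtype.ext
    ext i j
    exact congrFun (congrFun H (Sum.inl i)) (Sum.inl j)

theorem homog_inv_mul (g : Pose) : g.inv.homog * g.homog = 1 := by
  rw [← homog_mul]
  have : g.inv.mul g = ⟨0, 1⟩ := by
    apply Pose.ext
    · show -(g.Rᵀ *ᵥ g.pos) + g.inv.R *ᵥ g.pos = 0
      rw [R_inv]; simp
    · exact inv_mul_cancel g.rot
  rw [this]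
  ext (i | i) (j | j)
  · simp [homog, R, Matrix.one_apply]
  all_goals simp [homog]

theorem homog_inv (g : Pose) : g.inv.homog = g.homog⁻¹ :=
  (Matrix.inv_eq_left_inv g.homog_inv_mul).symm

theorem inv_mul_mul_inv (a b c : Pose) : b.inv.mul (a.inv.mul c) = (a.mul b).inv.mul c := by
  apply homog_injective
  simp only [homog_mul, homog_inv, Matrix.mul_inv_rev, Matrix.mul_assoc]

theorem pos_inv_mul (h g : Pose) : (h.inv.mul g).pos = h.Rᵀ *ᵥ (g.pos - h.pos) := by
  show -(h.Rᵀ *ᵥ h.pos) + h.inv.R *ᵥ g.pos = _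
  rw [R_inv, mulVec_sub]; abel

theorem euc_pos_inv_mul (h g : Pose) : euc (h.inv.mul g).pos = euc (g.pos - h.pos) := by
  rw [pos_inv_mul, euc_mulVec_of_transpose_mul_self]
  rw [transpose_transpose, R_mul_transpose]

theorem twistHat_Ad_mul (g : Pose) (V : I6 → ℝ) :
    twistHat (g.Ad *ᵥ V) * g.homog = g.homog * twistHat V := by
  have hV : g.Ad *ᵥ V = Sum.elim (g.R *ᵥ (V ∘ Sum.inl) + (hat g.pos * g.R) *ᵥ (V ∘ Sum.inr))
      (g.R *ᵥ (V ∘ Sum.inr)) := by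
    rw [Ad, fromBlocks_mulVec]
    simp
  rw [hV]
  simp only [twistHat, homog, fromBlocks_multiply, Sum.elim_comp_inl, Sum.elim_comp_inr]
  congr 1
  · simp [hat_conj g.R_mul_transpose g.det_R]
  · have hcross : hat (g.R *ᵥ (V ∘ Sum.inr)) *ᵥ g.pos
        = -((hat g.pos * g.R) *ᵥ (V ∘ Sum.inr)) := by
      rw [← mulVec_mulVec, hat_mulVec, hat_mulVec, ← cross_anticomm]
    simp only [Matrix.mul_one, ← replicateCol_mulVec, ← replicateCol_add, hcross, Matrix.mul_zero,
      add_zero]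
    congr 1
    abel
  · simp
  · simp

end Pose

/-! ### Differentiation -/

namespace HasMatDerivAt

variable {l m n : Type*} [Fintype m] {t : ℝ}

theorem mul {A : ℝ → Matrix l m ℝ} {B : ℝ → Matrix m n ℝ} {A' : Matrix l m ℝ}
    {B' : Matrix m n ℝ} (hA : HasMatDerivAt A A' t) (hB : HasMatDerivAt B B' t) :
    HasMatDerivAt (fun τ => A τ * B τ) (A' * B t + A t * B') t := by
  intro i j
  have h := HasDerivAt.fun_sum (u := Finset.univ) fun k _ => (hA i k).fun_mul (hB k j)
  simp only [Matrix.mul_apply, Matrix.add_apply, ← Finset.sum_add_distrib]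
  exact h

theorem const_mul (A : Matrix l m ℝ) {B : ℝ → Matrix m n ℝ} {B' : Matrix m n ℝ}
    (hB : HasMatDerivAt B B' t) : HasMatDerivAt (fun τ => A * B τ) (A * B') t := by
  intro i j
  have h := HasDerivAt.fun_sum (u := Finset.univ) fun k _ => (hB k j).const_mul (A i k)
  simp only [Matrix.mul_apply]
  exact h

/-- If `ġ = -g û` then `d/dt g⁻¹ = û g⁻¹`. -/
theorem homog_inv {g : ℝ → Pose} {u : I6 → ℝ}
    (h : HasMatDerivAt (fun τ => (g τ).homog) (-((g t).homog * twistHat u)) t) :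
    HasMatDerivAt (fun τ => (g τ).inv.homog) (twistHat u * (g t).inv.homog) t := by
  -- Since `R⁻¹ = Rᵀ`, the inverse pose is polynomial in the entries of the pose and no derivative
  -- of matrix inversion is needed.
  have hR' : ∀ i j, HasDerivAt (fun τ => (g τ).R i j)
      (-((g t).R * hat (u ∘ Sum.inr)) i j) t := by
    intro i j
    have := h (Sum.inl i) (Sum.inl j)
    simpa [Pose.homog, twistHat, fromBlocks_multiply] using this
  have hp' : ∀ i, HasDerivAt (fun τ => (g τ).pos i) (-((g t).R *ᵥ (u ∘ Sum.inl)) i) t := by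
    intro i
    have := h (Sum.inl i) (Sum.inr ())
    simpa [Pose.homog, twistHat, fromBlocks_multiply, Matrix.mul_apply, mulVec, dotProduct]
      using this
  rintro (i | i) (j | j)
  · simp only [Pose.homog_inl_inl, Pose.R_inv, transpose_apply]
    refine (hR' j i).congr_deriv ?_
    have h1 : ((g t).R * hat (u ∘ Sum.inr))ᵀ = -(hat (u ∘ Sum.inr) * (g t).Rᵀ) := by
      rw [transpose_mul, hat_transpose, Matrix.neg_mul]
    have h2 := congrFun (congrFun h1 i) j
    rw [transpose_apply] at h2
    rw [h2]
    simp [Pose.homog, twistHat, fromBlocks_multiply, Pose.R_inv]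
  · have h1 := (HasDerivAt.fun_sum (u := Finset.univ)
      fun k _ => (hR' k i).fun_mul (hp' k)).fun_neg
    refine h1.congr_deriv ?_
    have h3 : hat (u ∘ Sum.inr) *ᵥ (-((g t).Rᵀ *ᵥ (g t).pos)) + u ∘ Sum.inl =
        ((g t).R * hat (u ∘ Sum.inr))ᵀ *ᵥ (g t).pos +
          (g t).Rᵀ *ᵥ ((g t).R *ᵥ (u ∘ Sum.inl)) := by
      rw [transpose_mul, hat_transpose, mulVec_mulVec _ (g t).Rᵀ (g t).R, (g t).R_transpose_mul,
        one_mulVec, mulVec_neg, Matrix.neg_mul, neg_mulVec, mulVec_mulVec]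
    have h4 := congrFun h3 i
    have h5 : (twistHat u * (g t).inv.homog) (Sum.inl i) (Sum.inr j) =
        (hat (u ∘ Sum.inr) *ᵥ (-((g t).Rᵀ *ᵥ (g t).pos)) + u ∘ Sum.inl) i := by
      simp [Pose.homog, Pose.inv, twistHat, Matrix.mul_apply, mulVec,
        dotProduct]
    rw [h5, h4]
    simp only [Pi.add_apply]
    simp only [mulVec, dotProduct, transpose_apply]
    rw [← Finset.sum_add_distrib, ← Finset.sum_neg_distrib]
    refine Finset.sum_congr rfl fun k _ => ?_
    ring
  · exact (hasDerivAt_const t (0 : ℝ)).congr_deriv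
      (by simp [Pose.homog, twistHat, fromBlocks_multiply])
  · exact (hasDerivAt_const t ((1 : Matrix Unit Unit ℝ) i j)).congr_deriv
      (by simp [Pose.homog, twistHat, fromBlocks_multiply])

end HasMatDerivAt

namespace IsAxisAngle

variable {R : Matrix (Fin 3) (Fin 3) ℝ} {ξ : Fin 3 → ℝ} {θ : ℝ}

theorem axis_sq (h : IsAxisAngle R ξ θ) : ξ 0 ^ 2 + ξ 1 ^ 2 + ξ 2 ^ 2 = 1 := by
  have := euc_sq ξ
  rw [h.1] at this
  simp [dotProduct, Fin.sum_univ_three] at this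
  linarith

theorem vee_skew (h : IsAxisAngle R ξ θ) : vee ((1 / 2 : ℝ) • (R - Rᵀ)) = Real.sin θ • ξ := by
  rw [h.2.2.2]
  ext i
  fin_cases i <;> simp [vee, axisRot, hat] <;> ring

theorem transpose_mulVec_axis (h : IsAxisAngle R ξ θ) : Rᵀ *ᵥ ξ = ξ := by
  have hs := h.axis_sq
  rw [h.2.2.2]
  ext i
  fin_cases i <;>
    simp [axisRot, hat, vecMulVec_apply, mulVec, dotProduct, Fin.sum_univ_three, one_apply]
  · linear_combination (1 - Real.cos θ) * ξ 0 * hs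
  · linear_combination (1 - Real.cos θ) * ξ 1 * hs
  · linear_combination (1 - Real.cos θ) * ξ 2 * hs

theorem trace_one_sub (h : IsAxisAngle R ξ θ) :
    Matrix.trace (1 - R) = 2 * (1 - Real.cos θ) := by
  have hs := h.axis_sq
  rw [h.2.2.2]
  simp [axisRot, hat, vecMulVec_apply, trace, Fin.sum_univ_three]
  linear_combination (Real.cos θ - 1) * hs

theorem euc_errVec_sq {g : Pose} (h : IsAxisAngle g.R ξ θ) :
    euc g.errVec ^ 2 = euc g.pos ^ 2 + Real.sin θ ^ 2 := by
  rw [Pose.errVec, euc_sumElim_sq, h.vee_skew, euc_smul, h.1, mul_one, sq_abs]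

end IsAxisAngle

theorem euc_axisAngle_le (R : Matrix (Fin 3) (Fin 3) ℝ) : euc (axisAngle R) ≤ Real.pi := by
  unfold axisAngle
  split_ifs with h
  · obtain ⟨h1, h2, h3, -⟩ := h.choose_spec
    rw [euc_smul, h1, mul_one]
    exact abs_le.2 ⟨h2.le, h3⟩
  · simpa [euc] using Real.pi_pos.le

/-- The summand of the storage function that belongs to one error pose. -/
noncomputable def poseStorage (g : Pose) : ℝ := (1 / 2) * (euc g.pos ^ 2 + Matrix.trace (1 - g.R))

theorem storage_eq (g h : Pose) : storage g h = poseStorage g + poseStorage h := by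
  simp only [storage, poseStorage]; ring

theorem AdRot_mulVec (R : Matrix (Fin 3) (Fin 3) ℝ) (x : I6 → ℝ) :
    AdRot R *ᵥ x = Sum.elim (R *ᵥ (x ∘ Sum.inl)) (R *ᵥ (x ∘ Sum.inr)) := by
  rw [AdRot, fromBlocks_mulVec]
  simp

theorem AdRot_transpose (R : Matrix (Fin 3) (Fin 3) ℝ) : (AdRot R)ᵀ = AdRot Rᵀ := by
  simp [AdRot, fromBlocks_transpose]

theorem euc_AdRot_mulVec {R : Matrix (Fin 3) (Fin 3) ℝ} (hR : Rᵀ * R = 1) (x : I6 → ℝ) :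
    euc (AdRot R *ᵥ x) = euc x := by
  refine euc_mulVec_of_transpose_mul_self ?_ x
  rw [AdRot_transpose, AdRot, AdRot, fromBlocks_multiply]
  simp [hR]

/-- Passivity of rigid body motion. -/
theorem hasDerivAt_poseStorage {g : ℝ → Pose} {a b : I6 → ℝ} {t : ℝ}
    (hg : HasMatDerivAt (fun τ => (g τ).homog)
      (twistHat a * (g t).homog + (g t).homog * twistHat b) t)
    (hR : ∃ ξ θ, IsAxisAngle (g t).R ξ θ) :
    HasDerivAt (fun τ => poseStorage (g τ))
      ((g t).errVec ⬝ᵥ a + (g t).errVec ⬝ᵥ (AdRot (g t).R *ᵥ b)) t := by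
  obtain ⟨ξ, θ, hξ⟩ := hR
  have hfun : (fun τ => poseStorage (g τ)) = fun τ => (1 / 2) *
      ((∑ i, (g τ).pos i * (g τ).pos i) + (3 - ∑ i, (g τ).R i i)) := by
    ext τ
    rw [poseStorage, euc_sq]
    simp [trace, dotProduct, Fin.sum_univ_three]
  have hp := fun i => hg (Sum.inl i) (Sum.inr ())
  have hr := fun i => hg (Sum.inl i) (Sum.inl i)
  simp only [Pose.homog_inl_inr, Pose.homog_inl_inl] at hp hr
  have h1 := HasDerivAt.fun_sum (u := Finset.univ) fun i _ => (hp i).fun_mul (hp i)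
  have h2 := (HasDerivAt.fun_sum (u := Finset.univ) fun i _ => hr i).const_sub 3
  rw [hfun]
  refine ((h1.fun_add h2).const_mul (1 / 2)).congr_deriv ?_
  -- The rotational error is parallel to the axis, which `R` fixes, so the adjoint acts trivially on
  -- this component.
  have hinv : (g t).R.transpose *ᵥ vee ((1 / 2 : ℝ) • ((g t).R - (g t).Rᵀ)) =
      vee ((1 / 2 : ℝ) • ((g t).R - (g t).Rᵀ)) := by
    rw [hξ.vee_skew, mulVec_smul, hξ.transpose_mulVec_axis]
  have hrot : (g t).errVec ⬝ᵥ (AdRot (g t).R *ᵥ b) =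
      (g t).pos ⬝ᵥ ((g t).R *ᵥ (b ∘ Sum.inl)) +
        vee ((1 / 2 : ℝ) • ((g t).R - (g t).Rᵀ)) ⬝ᵥ (b ∘ Sum.inr) := by
    rw [AdRot_mulVec, Pose.errVec]
    conv_rhs => rw [← hinv]
    rw [mulVec_transpose, ← dotProduct_mulVec]
    simp [dotProduct]
  rw [hrot]
  simp only [Matrix.add_apply, Matrix.mul_apply, Fintype.sum_sum_type, Fin.sum_univ_three]
  simp [Pose.errVec, Pose.homog, twistHat, vee, hat, dotProduct, mulVec, Fin.sum_univ_three]
  ring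

/-! ### The gain -/

theorem outMat_mulVec_sumElim (R : Matrix (Fin 3) (Fin 3) ℝ) (x y : I6 → ℝ) :
    outMat R *ᵥ Sum.elim x y = Sum.elim x (y - AdRot Rᵀ *ᵥ x) := by
  rw [outMat, fromBlocks_mulVec]
  simp [neg_mulVec, neg_add_eq_sub]

/-- Needed for the infimum defining `lamK` to be a lower bound. The factor 3 comes from `‖N x‖² ≤ 3
‖x‖²`, uniformly in the rotation. -/
theorem bddBelow_eigenvalues_gain (Kc Ke : Matrix I6 I6 ℝ) :
    BddBelow {l | ∃ R : SO3, Module.End.HasEigenvalue (Matrix.toLin'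
      ((outMat (R : Matrix (Fin 3) (Fin 3) ℝ))ᵀ * gain Kc Ke * outMat R)) l} := by
  obtain ⟨C, hC, hK⟩ := exists_euc_mulVec_le (gain Kc Ke)
  refine ⟨-(3 * C), ?_⟩
  rintro l ⟨R, hl⟩
  obtain ⟨x, hx⟩ := hl.exists_hasEigenvector
  have hmem := hx.1
  rw [Module.End.mem_eigenspace_iff, Matrix.toLin'_apply] at hmem
  have hpos : 0 < x ⬝ᵥ x :=
    lt_of_le_of_ne (by rw [← euc_sq]; positivity) fun h => hx.2 (dotProduct_self_eq_zero.1 h.symm)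
  set z := outMat (R : Matrix (Fin 3) (Fin 3) ℝ) *ᵥ x with hz
  have h1 : l * (x ⬝ᵥ x) = z ⬝ᵥ (gain Kc Ke *ᵥ z) := by
    rw [← smul_eq_mul, ← dotProduct_smul, ← hmem, ← mulVec_mulVec, ← mulVec_mulVec,
      dotProduct_mulVec, vecMul_transpose]
  have h2 : -(C * euc z ^ 2) ≤ z ⬝ᵥ (gain Kc Ke *ᵥ z) := by
    have h := dotProduct_le_euc_mul (-z) (gain Kc Ke *ᵥ z)
    rw [neg_dotProduct, show euc (-z) = euc z by simp [euc]] at h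
    nlinarith [hK z, euc_nonneg z]
  have h3 : euc z ^ 2 ≤ 3 * (x ⬝ᵥ x) := by
    obtain ⟨xc, xe, rfl⟩ : ∃ xc xe, x = Sum.elim xc xe :=
      ⟨x ∘ Sum.inl, x ∘ Sum.inr, (Sum.elim_comp_inl_inr x).symm⟩
    rw [← euc_sq, hz, outMat_mulVec_sumElim, euc_sumElim_sq, euc_sumElim_sq]
    have h4 := euc_sub_le xe (AdRot (R : Matrix (Fin 3) (Fin 3) ℝ)ᵀ *ᵥ xc)
    have h5 : euc (AdRot (R : Matrix (Fin 3) (Fin 3) ℝ)ᵀ *ᵥ xc) = euc xc :=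
      euc_AdRot_mulVec (by rw [transpose_transpose]; exact Pose.R_mul_transpose ⟨0, R⟩) xc
    rw [h5] at h4
    nlinarith [euc_nonneg xc, euc_nonneg xe, sq_nonneg (euc xc - euc xe),
      euc_nonneg (xe - AdRot (R : Matrix (Fin 3) (Fin 3) ℝ)ᵀ *ᵥ xc)]
  have h6 : -(3 * C) * (x ⬝ᵥ x) ≤ l * (x ⬝ᵥ x) := by
    rw [h1]; nlinarith
  exact le_of_mul_le_mul_right h6 hpos

theorem lamK_mul_le {Kc Ke : Matrix I6 I6 ℝ} (hKc : Kc.IsSymm) (hKe : Ke.IsSymm) (R : SO3)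
    (x : I6 ⊕ I6 → ℝ) :
    lamK Kc Ke * euc x ^ 2 ≤ (outMat (R : Matrix (Fin 3) (Fin 3) ℝ) *ᵥ x) ⬝ᵥ
      (gain Kc Ke *ᵥ (outMat (R : Matrix (Fin 3) (Fin 3) ℝ) *ᵥ x)) := by
  have hgain : (gain Kc Ke)ᵀ = gain Kc Ke := by
    simp [gain, fromBlocks_transpose, hKc.eq, hKe.eq]
  have hsymm : ((outMat (R : Matrix (Fin 3) (Fin 3) ℝ))ᵀ * gain Kc Ke * outMat R).IsHermitian := by
    rw [Matrix.IsHermitian, conjTranspose_eq_transpose_of_trivial]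
    simp [transpose_mul, hgain, Matrix.mul_assoc]
  have h := mul_dotProduct_self_le_of_le_eigenvalues hsymm (m := lamK Kc Ke)
    (fun l hl => csInf_le (bddBelow_eigenvalues_gain Kc Ke) ⟨R, hl⟩) x
  rw [euc_sq]
  refine h.trans (le_of_eq ?_)
  rw [← mulVec_mulVec, ← mulVec_mulVec, dotProduct_mulVec, vecMul_transpose]

/-- The power balance of the closed loop. -/
theorem control_power_balance (Kc Ke : Matrix I6 I6 ℝ) (gce gee : Pose) (μ V : I6 → ℝ)
    {u : I6 ⊕ I6 → ℝ} (hu : u = control Kc Ke gce gee μ) :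
    (gce.errVec ⬝ᵥ (u ∘ Sum.inl) + gce.errVec ⬝ᵥ (AdRot gce.R *ᵥ (-(u ∘ Sum.inr)))) +
      (gee.errVec ⬝ᵥ (u ∘ Sum.inr) + gee.errVec ⬝ᵥ (AdRot gee.R *ᵥ V)) =
    -((outMat gce.R *ᵥ stackErr gce gee) ⬝ᵥ
        (gain Kc Ke *ᵥ (outMat gce.R *ᵥ stackErr gce gee)))
      + gee.errVec ⬝ᵥ (AdRot gee.R *ᵥ (V - μ)) := by
  set x := outMat gce.R *ᵥ stackErr gce gee with hx
  set y := gain Kc Ke *ᵥ x with hy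
  obtain ⟨yc, ye, hyce⟩ : ∃ yc ye, y = Sum.elim yc ye :=
    ⟨y ∘ Sum.inl, y ∘ Sum.inr, (Sum.elim_comp_inl_inr y).symm⟩
  set μ' := AdRot gee.R *ᵥ μ with hμ'
  have huc : u ∘ Sum.inl = -yc - AdRot gce.R *ᵥ μ' := by
    ext i; simp [hu, control, ← hx, ← hy, hyce, hμ']
  have hue : u ∘ Sum.inr = -ye - μ' := by
    ext i; simp [hu, control, ← hx, ← hy, hyce, hμ']
  rw [hyce, hx, stackErr, outMat_mulVec_sumElim, huc, hue, sumElim_dotProduct_sumElim,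
    mulVec_sub, ← hμ']
  -- This identity produces the off-diagonal block of `N`. The feedforward terms `μ'` cancel in the
  -- control channel and survive only in the estimation channel.
  have h1 : (AdRot gce.Rᵀ *ᵥ gce.errVec) ⬝ᵥ ye = gce.errVec ⬝ᵥ (AdRot gce.R *ᵥ ye) := by
    rw [← AdRot_transpose, mulVec_transpose, ← dotProduct_mulVec]
  simp only [sub_dotProduct, dotProduct_sub, dotProduct_neg, h1, neg_sub, sub_neg_eq_add,
    mulVec_add, dotProduct_add]
  ring

/-! ### Decrease of functions differentiable off a locally finite set -/

section Comparison

/-- Mean value inequality, by induction on the exceptional set: the interval is cut at each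
exceptional point and continuity glues the pieces. -/
theorem sub_le_mul_sub_of_deriv_le_off_finite {f : ℝ → ℝ} {κ : ℝ} {F : Set ℝ} (hF : F.Finite) :
    ∀ {a b : ℝ}, a ≤ b → ContinuousOn f (Set.Icc a b) →
      (∀ t ∈ Set.Ioo a b, t ∉ F → ∃ f', HasDerivAt f f' t ∧ f' ≤ κ) →
      f b - f a ≤ κ * (b - a) := by
  induction F, hF using Set.Finite.induction_on with
  | empty =>
    intro a b hab hf hd
    refine (convex_Icc a b).image_sub_le_mul_sub_of_deriv_le hf ?_ ?_ a
      (Set.left_mem_Icc.2 hab) b (Set.right_mem_Icc.2 hab) hab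
    · intro t ht
      rw [interior_Icc] at ht
      obtain ⟨f', h, -⟩ := hd t ht (Set.notMem_empty t)
      exact h.differentiableAt.differentiableWithinAt
    · intro t ht
      rw [interior_Icc] at ht
      obtain ⟨f', h, h'⟩ := hd t ht (Set.notMem_empty t)
      rwa [h.deriv]
  | @insert c F _ _ ih =>
    intro a b hab hf hd
    by_cases hc : c ∈ Set.Ioo a b
    · have h1 := ih hc.1.le (hf.mono (Set.Icc_subset_Icc_right hc.2.le)) fun t ht htF =>
        hd t ⟨ht.1, ht.2.trans hc.2⟩ fun h => h.elim (fun h => ht.2.ne h) htF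
      have h2 := ih hc.2.le (hf.mono (Set.Icc_subset_Icc_left hc.1.le)) fun t ht htF =>
        hd t ⟨hc.1.trans ht.1, ht.2⟩ fun h => h.elim (fun h => ht.1.ne' h) htF
      linarith
    · exact ih hab hf fun t ht htF =>
        hd t ht fun h => h.elim (fun h => hc (h ▸ ht)) htF

/-- A function that decreases at rate `κ` wherever it exceeds `r`, except on a locally finite
set, decreases linearly until it is below `r`, and stays there. -/
theorem le_max_of_deriv_le_neg {f : ℝ → ℝ} {κ r t₀ : ℝ} (hκ : 0 ≤ κ) {J : Set ℝ}
    (hJ : ∀ T, (J ∩ Set.Icc t₀ T).Finite) (hf : ContinuousOn f (Set.Ici t₀))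
    (hd : ∀ t > t₀, t ∉ J → r < f t → ∃ f', HasDerivAt f f' t ∧ f' ≤ -κ) {t : ℝ} (ht : t₀ ≤ t) :
    f t ≤ max r (f t₀ - κ * (t - t₀)) := by
  have hstep : ∀ a, t₀ ≤ a → a ≤ t → (∀ τ ∈ Set.Ioo a t, r < f τ) →
      f t - f a ≤ -κ * (t - a) := by
    intro a ha hat hr
    refine sub_le_mul_sub_of_deriv_le_off_finite (hJ t) hat
      (hf.mono fun τ hτ => ha.trans hτ.1) fun τ hτ hτJ => ?_
    have hτ0 : t₀ < τ := ha.trans_lt hτ.1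
    exact hd τ hτ0 (fun h => hτJ ⟨h, hτ0.le, hτ.2.le⟩) (hr τ hτ)
  by_cases hex : ∃ τ ∈ Set.Icc t₀ t, f τ ≤ r
  · have hcomp : IsCompact (Set.Icc t₀ t ∩ f ⁻¹' Set.Iic r) :=
      isCompact_Icc.of_isClosed_subset
        ((hf.mono fun τ hτ => hτ.1).preimage_isClosed_of_isClosed isClosed_Icc isClosed_Iic)
        Set.inter_subset_left
    -- The last time with `f ≤ r`. After it `f` is above `r`, hence decreasing, and cannot rise over
    -- its value there.
    obtain ⟨τ₁, hτ₁, hmax⟩ := hcomp.exists_isGreatest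
      (by obtain ⟨τ, h, h'⟩ := hex; exact ⟨τ, h, h'⟩)
    have h := hstep τ₁ hτ₁.1.1 hτ₁.1.2 fun τ hτ => lt_of_not_ge fun hle =>
      not_lt.2 (hmax ⟨⟨hτ₁.1.1.trans hτ.1.le, hτ.2.le⟩, hle⟩) hτ.1
    have h1 : f τ₁ ≤ r := hτ₁.2
    have h2 : 0 ≤ κ * (t - τ₁) := mul_nonneg hκ (by linarith [hτ₁.1.2])
    exact le_max_of_le_left (by linarith)
  · push Not at hex
    have h := hstep t₀ le_rfl ht fun τ hτ => hex τ ⟨hτ.1.le, hτ.2.le⟩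
    exact le_max_of_le_right (by linarith)

end Comparison

/-! ### Storage function and ellipse -/

namespace IsAxisAngle

variable {g : Pose} {ξ : Fin 3 → ℝ} {θ : ℝ}

theorem poseStorage_eq (h : IsAxisAngle g.R ξ θ) :
    poseStorage g = (1 / 2) * euc g.pos ^ 2 + (1 - Real.cos θ) := by
  rw [poseStorage, h.trace_one_sub]; ring

theorem euc_errVec (h : IsAxisAngle g.R ξ θ) :
    euc g.errVec = √(euc g.pos ^ 2 + Real.sin θ ^ 2) := by
  rw [← h.euc_errVec_sq, Real.sqrt_sq (euc_nonneg _)]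

theorem half_euc_errVec_sq_le (h : IsAxisAngle g.R ξ θ) :
    (1 / 2) * euc g.errVec ^ 2 ≤ poseStorage g := by
  rw [h.poseStorage_eq, h.euc_errVec_sq]
  nlinarith [Real.sin_sq_add_cos_sq θ, Real.cos_le_one θ, sq_nonneg (1 - Real.cos θ)]

/-- The angle restriction gives `0 ≤ cos θ ≤ 1`, hence `1 - cos θ ≤ 1 - cos² θ = sin² θ`. -/
theorem poseStorage_le (h : IsAxisAngle g.R ξ θ) (hθ : |θ| ≤ Real.pi / 2) :
    poseStorage g ≤ euc g.errVec ^ 2 := by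
  rw [h.poseStorage_eq, h.euc_errVec_sq]
  have hcos : 0 ≤ Real.cos θ := Real.cos_nonneg_of_mem_Icc (abs_le.1 hθ)
  nlinarith [Real.sin_sq_add_cos_sq θ, Real.cos_le_one θ, sq_nonneg (euc g.pos)]

end IsAxisAngle

/-- The quadratic defining function of the ellipse. -/
noncomputable def ellipseQuad (ρ c : ℝ) (gce gee : Pose) : ℝ :=
  euc gce.errVec ^ 2 + ρ * euc gee.errVec ^ 2 - 2 * ρ * c * euc gee.errVec

theorem ellipseQuad_eq (ρ c : ℝ) (gce gee : Pose) :
    ellipseQuad ρ c gce gee =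
      euc gce.errVec ^ 2 + ρ * (euc gee.errVec - c) ^ 2 - ρ * c ^ 2 := by
  rw [ellipseQuad]; ring

theorem ellipseQuad_antitone {ρ c c' : ℝ} (hρ : 0 ≤ ρ) (h : c ≤ c') (gce gee : Pose) :
    ellipseQuad ρ c' gce gee ≤ ellipseQuad ρ c gce gee := by
  have : 0 ≤ ρ * (c' - c) * euc gee.errVec :=
    mul_nonneg (mul_nonneg hρ (sub_nonneg.2 h)) (euc_nonneg _)
  rw [ellipseQuad, ellipseQuad]
  linarith

theorem ellipseE_nonpos_of_ellipseQuad_nonpos {lam lamt c : ℝ} (hρ : 0 ≤ lamt / lam) (hc : 0 ≤ c)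
    {gce gee : Pose} (h : ellipseQuad (lamt / lam) c gce gee ≤ 0) :
    ellipseE lam lamt c gce gee ≤ 0 := by
  rw [ellipseQuad_eq] at h
  have h1 : √(lamt / lam) * c = √(lamt / lam * c ^ 2) := by
    rw [Real.sqrt_mul hρ, Real.sqrt_sq hc]
  rw [ellipseE, h1, sub_nonpos]
  exact Real.sqrt_le_sqrt (by linarith)

/-- Squaring `ε + √ρ c ≤ √(...)` leaves `ε²` and a nonnegative cross term. It converts distance from
the ellipse into a decay rate. -/
theorem sq_le_ellipseQuad {lam lamt c ε : ℝ} (hρ : 0 ≤ lamt / lam) (hc : 0 ≤ c) (hε : 0 ≤ ε)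
    {gce gee : Pose} (h : ε ≤ ellipseE lam lamt c gce gee) :
    ε ^ 2 ≤ ellipseQuad (lamt / lam) c gce gee := by
  rw [ellipseQuad_eq]
  rw [ellipseE] at h
  have h0 : 0 ≤ √(lamt / lam) * c := mul_nonneg (Real.sqrt_nonneg _) hc
  have h1 : (ε + √(lamt / lam) * c) ^ 2 ≤
      euc gce.errVec ^ 2 + lamt / lam * (euc gee.errVec - c) ^ 2 := by
    rw [← Real.sq_sqrt (show 0 ≤ euc gce.errVec ^ 2 + lamt / lam * (euc gee.errVec - c) ^ 2 by
      positivity)]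
    exact pow_le_pow_left₀ (by linarith) (by linarith) 2
  have h2 : (√(lamt / lam) * c) ^ 2 = lamt / lam * c ^ 2 := by rw [mul_pow, Real.sq_sqrt hρ]
  nlinarith [mul_nonneg hε h0]

theorem ellipseQuad_pos {lam lamt c : ℝ} (hρ : 0 ≤ lamt / lam) (hc : 0 ≤ c)
    {gce gee : Pose} (h : 0 < ellipseE lam lamt c gce gee) :
    0 < ellipseQuad (lamt / lam) c gce gee :=
  lt_of_lt_of_le (pow_pos h 2) (sq_le_ellipseQuad hρ hc h.le le_rfl)

theorem axisRot_first_axis (θ : ℝ) : axisRot ![1, 0, 0] θ =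
    !![1, 0, 0; 0, Real.cos θ, -Real.sin θ; 0, Real.sin θ, Real.cos θ] := by
  ext i j
  fin_cases i <;> fin_cases j <;> simp [axisRot, hat]

/-- A pose with given distance of the position from the origin and given rotation angle. -/
noncomputable def samplePose (p θ : ℝ) : Pose :=
  ⟨![p, 0, 0], axisRot ![1, 0, 0] θ, by
    rw [Matrix.mem_specialOrthogonalGroup_iff, Matrix.mem_orthogonalGroup_iff,
      axisRot_first_axis]
    have h := Real.sin_sq_add_cos_sq θ
    constructor
    · ext i j
      fin_cases i <;> fin_cases j <;>
        simp [Matrix.mul_apply, Fin.sum_univ_three] <;> linarith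
    · rw [Matrix.det_fin_three]
      simp
      linarith⟩

theorem isAxisAngle_samplePose (p : ℝ) {θ : ℝ} (hθ : |θ| ≤ Real.pi / 2) :
    IsAxisAngle (samplePose p θ).R ![1, 0, 0] θ := by
  have hpi := Real.pi_pos
  have := abs_le.1 hθ
  refine ⟨?_, by linarith, by linarith, rfl⟩
  rw [← sq_eq_sq₀ (euc_nonneg _) zero_le_one, euc_sq]
  simp [dotProduct, Fin.sum_univ_three]

theorem euc_pos_samplePose_sq (p θ : ℝ) : euc (samplePose p θ).pos ^ 2 = p ^ 2 := by
  rw [euc_sq]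
  simp [samplePose, dotProduct, Fin.sum_univ_three, sq]

/-- The zero error lies in the ellipse and has zero storage. -/
theorem StorageBoundOnEllipse.nonneg {lam lamt c r : ℝ} (hρ : 0 ≤ lamt / lam) (hc : 0 ≤ c)
    (h : StorageBoundOnEllipse lam lamt c r) : 0 ≤ r := by
  have h0 : |(0 : ℝ)| ≤ Real.pi / 2 := by rw [abs_zero]; positivity
  have hax := isAxisAngle_samplePose 0 h0
  have herr : euc (samplePose 0 0).errVec = 0 := by
    rw [hax.euc_errVec, euc_pos_samplePose_sq]; simp
  have hst : storage (samplePose 0 0) (samplePose 0 0) = 0 := by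
    rw [storage_eq, hax.poseStorage_eq, euc_pos_samplePose_sq]; simp
  rw [← hst]
  refine h _ _ ⟨_, _, hax, h0⟩ ⟨_, _, hax, h0⟩ (ellipseE_nonpos_of_ellipseQuad_nonpos hρ hc ?_)
  simp [ellipseQuad, herr]

theorem one_le_ellipseQuad {ρ c B : ℝ} (hρ : 0 < ρ) (hc : 0 ≤ c)
    (hB : B = (1 + ρ * c ^ 2) + (c + (1 + ρ * c ^ 2) / ρ + 1)) {gce gee : Pose}
    (h : B ≤ euc gce.errVec ∨ B ≤ euc gee.errVec) : 1 ≤ ellipseQuad ρ c gce gee := by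
  rw [ellipseQuad_eq]
  have h0 : 0 ≤ ρ * c ^ 2 := by positivity
  have h1 : 0 ≤ (1 + ρ * c ^ 2) / ρ := by positivity
  rcases h with h | h
  · have h2 : 1 + ρ * c ^ 2 ≤ euc gce.errVec := by linarith
    have h3 : 0 ≤ ρ * (euc gee.errVec - c) ^ 2 := by positivity
    nlinarith
  · have h2 : (1 + ρ * c ^ 2) / ρ + 1 ≤ euc gee.errVec - c := by linarith
    have h3 : (1 + ρ * c ^ 2) / ρ ≤ (euc gee.errVec - c) ^ 2 := by nlinarith
    rw [div_le_iff₀ hρ] at h3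
    nlinarith [sq_nonneg (euc gce.errVec)]

/-- Outside a sublevel set of the storage function that contains the ellipse with margin `ε`, the
defining function of the ellipse is bounded away from zero. -/
theorem exists_margin {lam lamt c ε : ℝ} (hρ : 0 < lamt / lam) (hc : 0 ≤ c) (hε : 0 < ε) :
    ∃ κ > 0, ∀ r, StorageBoundOnEllipse lam lamt c r → ∀ gce gee : Pose,
      (∃ ξ θ, IsAxisAngle gce.R ξ θ ∧ |θ| ≤ Real.pi / 2) →
      (∃ ξ θ, IsAxisAngle gee.R ξ θ ∧ |θ| ≤ Real.pi / 2) →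
      r + ε < storage gce gee → κ ≤ ellipseQuad (lamt / lam) c gce gee := by
  by_cases hne : ∃ r, StorageBoundOnEllipse lam lamt c r
  swap
  · exact ⟨1, one_pos, fun r hr => absurd ⟨r, hr⟩ hne⟩
  set ρ := lamt / lam with hρdef
  -- The least admissible level is itself admissible; a margin found for `r₀` serves every `r`, so
  -- `κ` does not depend on `r`.
  set r₀ := sInf {r | StorageBoundOnEllipse lam lamt c r} with hr₀
  have hr₀le : ∀ r, StorageBoundOnEllipse lam lamt c r → r₀ ≤ r := fun r hr =>
    csInf_le ⟨0, fun r hr => StorageBoundOnEllipse.nonneg hρ.le hc hr⟩ hr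
  have hr₀bd : StorageBoundOnEllipse lam lamt c r₀ := fun gce gee h1 h2 h3 =>
    le_csInf hne fun r hr => hr gce gee h1 h2 h3
  obtain ⟨B, hB⟩ : ∃ B, B = (1 + ρ * c ^ 2) + (c + (1 + ρ * c ^ 2) / ρ + 1) := ⟨_, rfl⟩
  -- Storage and ellipse depend only on the two position norms and the two angles. This reduces the
  -- compactness argument to a box in `ℝ⁴`, each point of which is realized by sample poses.
  let f : ℝ × ℝ × ℝ × ℝ → ℝ := fun x => (x.1 ^ 2 + Real.sin x.2.1 ^ 2) +
    ρ * √(x.2.2.1 ^ 2 + Real.sin x.2.2.2 ^ 2) ^ 2 -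
      2 * ρ * c * √(x.2.2.1 ^ 2 + Real.sin x.2.2.2 ^ 2)
  let s : ℝ × ℝ × ℝ × ℝ → ℝ := fun x => ((1 / 2) * x.1 ^ 2 + (1 - Real.cos x.2.1)) +
    ((1 / 2) * x.2.2.1 ^ 2 + (1 - Real.cos x.2.2.2))
  have hf : Continuous f := by fun_prop
  have hs : Continuous s := by fun_prop
  have hfE : ∀ {gce gee : Pose} {ξ₁ ξ₂ θ₁ θ₂ p₁ p₂}, IsAxisAngle gce.R ξ₁ θ₁ →
      IsAxisAngle gee.R ξ₂ θ₂ → euc gce.pos ^ 2 = p₁ ^ 2 → euc gee.pos ^ 2 = p₂ ^ 2 →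
      ellipseQuad ρ c gce gee = f (p₁, θ₁, p₂, θ₂) ∧ storage gce gee = s (p₁, θ₁, p₂, θ₂) := by
    intro gce gee ξ₁ ξ₂ θ₁ θ₂ p₁ p₂ h1 h2 h3 h4
    refine ⟨?_, ?_⟩
    · rw [ellipseQuad, h1.euc_errVec_sq, h2.euc_errVec, h3, h4]
    · rw [storage_eq, h1.poseStorage_eq, h2.poseStorage_eq, h3, h4]
  let I : Set ℝ := Set.Icc (-(Real.pi / 2)) (Real.pi / 2)
  let box : Set (ℝ × ℝ × ℝ × ℝ) := Set.Icc 0 B ×ˢ I ×ˢ Set.Icc 0 B ×ˢ I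
  have hbox : IsCompact box :=
    isCompact_Icc.prod (isCompact_Icc.prod (isCompact_Icc.prod isCompact_Icc))
  have hcomp : IsCompact (box ∩ s ⁻¹' Set.Ici (r₀ + ε)) :=
    hbox.inter_right (isClosed_Ici.preimage hs)
  have hpos : ∀ x ∈ box ∩ s ⁻¹' Set.Ici (r₀ + ε), 0 < f x := by
    rintro ⟨p₁, θ₁, p₂, θ₂⟩ ⟨⟨-, hθ₁, -, hθ₂⟩, hx⟩
    have h1 := isAxisAngle_samplePose p₁ (abs_le.2 hθ₁)
    have h2 := isAxisAngle_samplePose p₂ (abs_le.2 hθ₂)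
    obtain ⟨e1, e2⟩ := hfE h1 h2 (euc_pos_samplePose_sq _ _) (euc_pos_samplePose_sq _ _)
    by_contra hcon
    rw [← e1, not_lt] at hcon
    have h3 := hr₀bd _ _ ⟨_, _, h1, abs_le.2 hθ₁⟩ ⟨_, _, h2, abs_le.2 hθ₂⟩
      (ellipseE_nonpos_of_ellipseQuad_nonpos hρ.le hc hcon)
    rw [e2] at h3
    have h4 : r₀ + ε ≤ s (p₁, θ₁, p₂, θ₂) := hx
    linarith
  obtain ⟨κ, hκ, hκf⟩ : ∃ κ > 0, ∀ x ∈ box ∩ s ⁻¹' Set.Ici (r₀ + ε), κ ≤ f x := by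
    rcases Set.eq_empty_or_nonempty (box ∩ s ⁻¹' Set.Ici (r₀ + ε)) with h | h
    · exact ⟨1, one_pos, fun x hx => absurd hx (h ▸ Set.notMem_empty x)⟩
    · obtain ⟨x, hx, hmin⟩ := hcomp.exists_isMinOn h hf.continuousOn
      exact ⟨f x, hpos x hx, fun y hy => hmin hy⟩
  refine ⟨min κ 1, lt_min hκ one_pos, ?_⟩
  rintro r hr gce gee ⟨ξ₁, θ₁, h1, hθ₁⟩ ⟨ξ₂, θ₂, h2, hθ₂⟩ hS
  by_cases hbig : B ≤ euc gce.errVec ∨ B ≤ euc gee.errVec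
  · exact (min_le_right _ _).trans (one_le_ellipseQuad hρ hc hB hbig)
  push Not at hbig
  obtain ⟨e1, e2⟩ := hfE h1 h2 rfl rfl
  refine (min_le_left _ _).trans ?_
  rw [e1]
  have hle : ∀ {g : Pose} {ξ θ}, IsAxisAngle g.R ξ θ → euc g.pos ≤ euc g.errVec := by
    intro g ξ θ h
    rw [h.euc_errVec]
    exact Real.le_sqrt_of_sq_le (by nlinarith [sq_nonneg (Real.sin θ)])
  refine hκf _ ⟨⟨⟨euc_nonneg _, (hle h1).trans hbig.1.le⟩, abs_le.1 hθ₁,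
    ⟨euc_nonneg _, (hle h2).trans hbig.2.le⟩, abs_le.1 hθ₂⟩, ?_⟩
  show r₀ + ε ≤ s _
  rw [← e2]
  linarith [hr₀le r hr]

/-! ### Error dynamics and dissipation along solutions -/

theorem twistHat_neg (V : I6 → ℝ) : twistHat (-V) = -twistHat V := by
  ext (i | i) (j | j)
  · fin_cases i <;> fin_cases j <;> simp [twistHat, hat]
  all_goals simp [twistHat]

theorem poseStorage_inv_mul (h g : Pose) : poseStorage (h.inv.mul g) =
    (1 / 2) * ((∑ i, (g.pos i - h.pos i) ^ 2) + (3 - ∑ i, ∑ k, h.R k i * g.R k i)) := by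
  rw [poseStorage, Pose.euc_pos_inv_mul, euc_sq, Pose.R_mul, Pose.R_inv, trace_sub, trace_one]
  simp [trace, dotProduct, Matrix.mul_apply, sq]

theorem continuousOn_poseStorage_inv_mul {h g : ℝ → Pose} {s : Set ℝ}
    (hh : ContinuousOn (fun t => (h t).homog) s) (hg : ContinuousOn (fun t => (g t).homog) s) :
    ContinuousOn (fun t => poseStorage ((h t).inv.mul (g t))) s := by
  have hent : ∀ {g : ℝ → Pose}, ContinuousOn (fun t => (g t).homog) s → ∀ i j,
      ContinuousOn (fun t => (g t).homog i j) s := fun hg i j =>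
    (continuous_apply_apply i j).comp_continuousOn hg
  have hp : ∀ {g : ℝ → Pose}, ContinuousOn (fun t => (g t).homog) s → ∀ i,
      ContinuousOn (fun t => (g t).pos i) s := fun hg i => hent hg (Sum.inl i) (Sum.inr ())
  have hr : ∀ {g : ℝ → Pose}, ContinuousOn (fun t => (g t).homog) s → ∀ i j,
      ContinuousOn (fun t => (g t).R i j) s := fun hg i j => hent hg (Sum.inl i) (Sum.inl j)
  simp only [poseStorage_inv_mul]
  refine continuousOn_const.mul (ContinuousOn.add ?_ (continuousOn_const.sub ?_))
  · exact continuousOn_finsetSum _ fun i _ => ((hp hg i).sub (hp hh i)).pow 2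
  · exact continuousOn_finsetSum _ fun i _ => continuousOn_finsetSum _ fun k _ =>
      (hr hh k i).mul (hr hg k i)

/-- The camera pose cancels when target and estimate are compared in the world frame, so the camera
velocity drops out of the kinematics of the estimation error. -/
theorem Signals.gee_eq {Mbar : ℕ} (q : Signals Mbar) (t : ℝ) :
    q.gee t = (q.gwoBar t).inv.mul (q.gwo t) := Pose.inv_mul_mul_inv _ _ _

namespace IsClosedLoop

variable {Mbar : ℕ} {D W : Set (Fin 3 → ℝ)} {gd : Pose} {Kc Ke : Matrix I6 I6 ℝ}
  {v mean : Fin Mbar → (I6 → ℝ) → I6 → ℝ} {q : Signals Mbar}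

section

variable (h : IsClosedLoop D W gd Kc Ke v mean q)
include h

theorem continuousOn_S : ContinuousOn (q.S gd) (Set.Ici 0) := by
  have h1 : ContinuousOn (fun t => poseStorage (q.gce gd t)) (Set.Ici 0) :=
    continuousOn_poseStorage_inv_mul (h := fun _ => gd) continuousOn_const h.cont_bar
  have h2 : ContinuousOn (fun t => poseStorage (q.gee t)) (Set.Ici 0) := by
    simp only [Signals.gee_eq]
    refine continuousOn_poseStorage_inv_mul ?_ h.cont_wo
    simp only [Signals.gwoBar, Pose.homog_mul]
    exact h.cont_wc.mul h.cont_bar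
  refine (h1.add h2).congr fun t _ => ?_
  exact storage_eq _ _

theorem half_sq_le_S {t : ℝ} (ht : 0 ≤ t) : (1 / 2) * euc (q.e gd t) ^ 2 ≤ q.S gd t := by
  obtain ⟨ξ₁, θ₁, h1, -⟩ := h.angle_ce t ht
  obtain ⟨ξ₂, θ₂, h2, -⟩ := h.angle_ee t ht
  rw [Signals.e, Signals.S, stackErr, euc_sumElim_sq, storage_eq]
  linarith [h1.half_euc_errVec_sq_le, h2.half_euc_errVec_sq_le]

theorem S_le_sq {t : ℝ} (ht : 0 ≤ t) : q.S gd t ≤ euc (q.e gd t) ^ 2 := by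
  obtain ⟨ξ₁, θ₁, h1, hθ₁⟩ := h.angle_ce t ht
  obtain ⟨ξ₂, θ₂, h2, hθ₂⟩ := h.angle_ee t ht
  rw [Signals.e, Signals.S, stackErr, euc_sumElim_sq, storage_eq]
  linarith [h1.poseStorage_le hθ₁.le, h2.poseStorage_le hθ₂.le]

theorem S_nonneg {t : ℝ} (ht : 0 ≤ t) : 0 ≤ q.S gd t :=
  le_trans (by positivity) (h.half_sq_le_S ht)

theorem hasMatDerivAt_gce {t : ℝ} (ht : 0 < t) (htJ : t ∉ q.J) :
    HasMatDerivAt (fun τ => (q.gce gd τ).homog)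
      (twistHat (q.u gd Kc Ke mean t ∘ Sum.inl) * (q.gce gd t).homog +
        (q.gce gd t).homog * twistHat (-(q.u gd Kc Ke mean t ∘ Sum.inr))) t := by
  have h1 := (h.ode_bar t ht htJ).const_mul gd.inv.homog
  have h2 := gd.inv.twistHat_Ad_mul (q.Vwc t)
  simp only [Signals.gce, Pose.homog_mul]
  have h3 : gd.inv.homog * (twistHat (q.Vwc t) * (q.gbar t).homog) =
      twistHat (gd.inv.Ad *ᵥ q.Vwc t) * (gd.inv.homog * (q.gbar t).homog) := by
    rw [← Matrix.mul_assoc, ← h2, Matrix.mul_assoc]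
  convert h1 using 1
  rw [h.input_c t ht htJ, twistHat_neg, twistHat_neg, Matrix.mul_sub, Matrix.mul_neg _ (_ * _), h3]
  simp only [Matrix.neg_mul, Matrix.mul_neg, Matrix.mul_assoc, sub_eq_add_neg]

theorem hasMatDerivAt_gee {t : ℝ} (ht : 0 < t) (htJ : t ∉ q.J) :
    HasMatDerivAt (fun τ => (q.gee τ).homog)
      (twistHat (q.u gd Kc Ke mean t ∘ Sum.inr) * (q.gee t).homog +
        (q.gee t).homog * twistHat (v (q.s t) (q.gwo t).vec)) t := by
  have h1 : HasMatDerivAt (fun τ => (q.gwoBar τ).homog)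
      (-((q.gwoBar t).homog * twistHat (q.u gd Kc Ke mean t ∘ Sum.inr))) t := by
    have := (h.ode_wc t ht htJ).mul (h.ode_bar t ht htJ)
    simp only [Signals.gwoBar, Pose.homog_mul]
    convert this using 1
    noncomm_ring
  have h2 := h1.homog_inv.mul (h.ode_wo t ht htJ)
  simp only [Signals.gee_eq, Pose.homog_mul]
  convert h2 using 1
  simp only [Matrix.mul_assoc]

/-- Dissipation inequality. -/
theorem exists_deriv_S_le (hKc : Kc.IsSymm) (hKe : Ke.IsSymm) {t : ℝ} (ht : 0 < t)
    (htJ : t ∉ q.J) :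
    ∃ S', HasDerivAt (q.S gd) S' t ∧
      S' ≤ -(lamK Kc Ke * (euc (q.gce gd t).errVec ^ 2 + euc (q.gee t).errVec ^ 2)) +
        euc (q.gee t).errVec *
          euc (v (q.s t) (q.gwo t).vec - mean (q.s t) (q.gwoBar t).vec) := by
  obtain ⟨ξ₁, θ₁, h1, -⟩ := h.angle_ce t ht.le
  obtain ⟨ξ₂, θ₂, h2, -⟩ := h.angle_ee t ht.le
  have hc := hasDerivAt_poseStorage (h.hasMatDerivAt_gce ht htJ) ⟨_, _, h1⟩
  have he := hasDerivAt_poseStorage (h.hasMatDerivAt_gee ht htJ) ⟨_, _, h2⟩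
  have hsum := hc.fun_add he
  rw [control_power_balance Kc Ke (q.gce gd t) (q.gee t) (mean (q.s t) (q.gwoBar t).vec)
    (v (q.s t) (q.gwo t).vec) (u := q.u gd Kc Ke mean t) rfl] at hsum
  have hfun : q.S gd = fun τ => poseStorage (q.gce gd τ) + poseStorage (q.gee τ) :=
    funext fun τ => storage_eq _ _
  refine ⟨_, hfun ▸ hsum, ?_⟩
  have hlam := lamK_mul_le hKc hKe (q.gce gd t).rot (stackErr (q.gce gd t) (q.gee t))
  have hsq : euc (stackErr (q.gce gd t) (q.gee t)) ^ 2 =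
      euc (q.gce gd t).errVec ^ 2 + euc (q.gee t).errVec ^ 2 := euc_sumElim_sq _ _
  have hcs := dotProduct_le_euc_mul (q.gee t).errVec
    (AdRot (q.gee t).R *ᵥ (v (q.s t) (q.gwo t).vec - mean (q.s t) (q.gwoBar t).vec))
  rw [euc_AdRot_mulVec (q.gee t).R_transpose_mul] at hcs
  rw [hsq] at hlam
  exact add_le_add (neg_le_neg hlam) hcs

/-- The position part of the Lipschitz bound is absorbed into the quadratic term. The axis-angle
vector is discontinuous at half turns, so its difference is only bounded by `2π`; with `bs` this
yields the linear coefficient `2 lamt c = bs + 2π Lθ`. -/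
theorem exists_deriv_S_le_ellipseQuad (hKc : Kc.IsSymm) (hKe : Ke.IsSymm) (hDW : D ⊆ W)
    {Lp Lθ lamt bs t : ℝ} (ht : 0 < t) (htJ : t ∉ q.J) (hLip : IsLipschitzPair W (v (q.s t)) Lp Lθ)
    (hlamt : lamt = lamK Kc Ke - Lp) (hpos : 0 < lamt)
    (hbs : euc (v (q.s t) (q.gwoBar t).vec - mean (q.s t) (q.gwoBar t).vec) ≤ bs) :
    ∃ S', HasDerivAt (q.S gd) S' t ∧ S' ≤ -(lamK Kc Ke *
      ellipseQuad (lamt / lamK Kc Ke) (ellipseSize lamt Lθ bs) (q.gce gd t) (q.gee t)) := by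
  obtain ⟨S', hS', hle⟩ := h.exists_deriv_S_le hKc hKe ht htJ
  refine ⟨S', hS', hle.trans ?_⟩
  obtain ⟨hLp, hLθ, hL⟩ := hLip
  have hlam : 0 < lamK Kc Ke := by linarith
  have h1 := hL (q.gwo t) (q.gwoBar t) (hDW (h.target_mem t ht.le)) (h.estimate_mem t ht.le)
  have h2 : euc ((q.gwo t).pos - (q.gwoBar t).pos) ≤ euc (q.gee t).errVec := by
    obtain ⟨ξ, θ, hax, -⟩ := h.angle_ee t ht.le
    rw [← Pose.euc_pos_inv_mul, ← Signals.gee_eq, hax.euc_errVec]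
    exact Real.le_sqrt_of_sq_le (by nlinarith [sq_nonneg (Real.sin θ)])
  have h3 : euc (axisAngle (q.gwo t).R - axisAngle (q.gwoBar t).R) ≤ 2 * Real.pi := by
    have := euc_sub_le (axisAngle (q.gwo t).R) (axisAngle (q.gwoBar t).R)
    linarith [euc_axisAngle_le (q.gwo t).R, euc_axisAngle_le (q.gwoBar t).R]
  have h4 : euc (v (q.s t) (q.gwo t).vec - mean (q.s t) (q.gwoBar t).vec) ≤
      Lp * euc (q.gee t).errVec + Lθ * (2 * Real.pi) + bs := by
    have h5 := euc_add_le (v (q.s t) (q.gwo t).vec - v (q.s t) (q.gwoBar t).vec)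
      (v (q.s t) (q.gwoBar t).vec - mean (q.s t) (q.gwoBar t).vec)
    rw [sub_add_sub_cancel] at h5
    linarith [mul_le_mul_of_nonneg_left h2 hLp, mul_le_mul_of_nonneg_left h3 hLθ]
  have h6 := mul_le_mul_of_nonneg_left h4 (euc_nonneg (q.gee t).errVec)
  have h7 : lamK Kc Ke * ellipseQuad (lamt / lamK Kc Ke) (ellipseSize lamt Lθ bs)
      (q.gce gd t) (q.gee t) = lamK Kc Ke * euc (q.gce gd t).errVec ^ 2 +
        lamt * euc (q.gee t).errVec ^ 2 -
          (bs + 2 * Real.pi * Lθ) * euc (q.gee t).errVec := by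
    rw [ellipseQuad, ellipseSize]
    field_simp
  rw [h7, hlamt]
  linarith

/-- If the storage function decreases at rate `κ` above the level `r`, then it is below `r` after
the time `T` with `κ T ≥ a²`. -/
theorem S_le_of_decrease {κ r t₀ a T : ℝ} (hκ : 0 ≤ κ) (hr : 0 ≤ r) (ht₀ : 0 ≤ t₀)
    (hT : a ^ 2 ≤ κ * T) (hT0 : 0 ≤ T) (ha : euc (q.e gd t₀) ≤ a)
    (hd : ∀ t > t₀, t ∉ q.J → r < q.S gd t → ∃ S', HasDerivAt (q.S gd) S' t ∧ S' ≤ -κ)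
    {t : ℝ} (ht : t₀ + T ≤ t) : q.S gd t ≤ r := by
  have hS := le_max_of_deriv_le_neg (J := q.J) hκ
    (fun T => (h.locallyFinite T).subset fun τ hτ => ⟨hτ.1, ht₀.trans hτ.2.1, hτ.2.2⟩)
    (h.continuousOn_S.mono fun τ hτ => ht₀.trans hτ) hd (by linarith : t₀ ≤ t)
  have h0 : q.S gd t₀ ≤ a ^ 2 :=
    (h.S_le_sq ht₀).trans (pow_le_pow_left₀ (euc_nonneg _) ha 2)
  have h1 : κ * T ≤ κ * (t - t₀) := mul_le_mul_of_nonneg_left (by linarith) hκ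
  exact hS.trans (max_le le_rfl (by linarith))

end

/-- Uniform ultimate boundedness under a bounded model error. -/
theorem exists_ultimate_bound (hKc : Kc.IsSymm) (hKe : Ke.IsSymm) (hDW : D ⊆ W)
    (hlam : 0 < lamK Kc Ke) {C : ℝ}
    (hbd : ∀ ψ, ∀ g g' : Pose, g.pos ∈ W → g'.pos ∈ W →
      euc (v ψ g.vec - mean ψ g'.vec) ≤ C) :
    ∃ b > 0, ∀ a > 0, ∃ T ≥ 0, ∀ q : Signals Mbar,
      IsClosedLoop D W gd Kc Ke v mean q → ∀ t₀ ≥ 0, euc (q.e gd t₀) ≤ a →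
        ∀ t ≥ t₀ + T, euc (q.e gd t) ≤ b := by
  set lam := lamK Kc Ke
  have hr0 : 0 < (2 * C / lam) ^ 2 + 1 := by positivity
  -- Where `S > r`, also `‖e‖² > r`, so `C ‖e‖ ≤ λ ‖e‖² / 2` and `S` decreases at rate `λ r / 2`;
  -- the summand 1 keeps this rate positive. The bound `√(2 r)` comes from `‖e‖² / 2 ≤ S`.
  obtain ⟨r, hr⟩ : ∃ r, r = (2 * C / lam) ^ 2 + 1 := ⟨_, rfl⟩
  rw [← hr] at hr0
  refine ⟨√(2 * r), by positivity, fun a ha => ⟨a ^ 2 / (lam * r / 2), by positivity, ?_⟩⟩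
  intro q h t₀ ht₀ hat₀ t ht
  have ht0 : 0 ≤ t := by
    have : 0 ≤ a ^ 2 / (lam * r / 2) := by positivity
    linarith
  have hS : q.S gd t ≤ r := by
    refine h.S_le_of_decrease (κ := lam * r / 2) (by positivity) hr0.le ht₀
      (le_of_eq ?_) (by positivity) hat₀ ?_ ht
    · field_simp
    intro τ hτ hτJ hSτ
    have hτ0 : 0 < τ := ht₀.trans_lt hτ
    obtain ⟨S', hS', hle⟩ := h.exists_deriv_S_le hKc hKe hτ0 hτJ
    refine ⟨S', hS', hle.trans ?_⟩
    have h1 := h.S_le_sq hτ0.le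
    have h2 := hbd (q.s τ) (q.gwo τ) (q.gwoBar τ) (hDW (h.target_mem τ hτ0.le))
      (h.estimate_mem τ hτ0.le)
    have hsq : euc (q.e gd τ) ^ 2 =
      euc (q.gce gd τ).errVec ^ 2 + euc (q.gee τ).errVec ^ 2 := euc_sumElim_sq _ _
    rw [← hsq]
    set x := euc (q.e gd τ) with hx
    have hx0 : 0 ≤ x := euc_nonneg _
    have h3 : euc (q.gee τ).errVec ≤ x := by
      refine le_of_sq_le_sq ?_ hx0
      rw [hsq]; nlinarith [sq_nonneg (euc (q.gce gd τ).errVec)]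
    have h4 : 2 * C / lam ≤ x := le_of_sq_le_sq (by linarith) hx0
    rw [div_le_iff₀ hlam] at h4
    have h5 : euc (q.gee τ).errVec *
        euc (v (q.s τ) (q.gwo τ).vec - mean (q.s τ) (q.gwoBar τ).vec) ≤ x * C :=
      mul_le_mul h3 h2 (euc_nonneg _) hx0
    have h6 : lam * r ≤ lam * x ^ 2 := mul_le_mul_of_nonneg_left (by linarith) hlam.le
    nlinarith
  exact Real.le_sqrt_of_sq_le (by linarith [h.half_sq_le_S ht0])

end IsClosedLoop

/-! ### Convergence times -/

theorem ellipseSize_nonneg {lamt Lθ bs : ℝ} (h : 0 < lamt) (hL : 0 ≤ Lθ) (hbs : 0 ≤ bs) :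
    0 ≤ ellipseSize lamt Lθ bs := by
  unfold ellipseSize
  have := Real.pi_pos
  positivity

/-- Reaching neighbourhoods of the ellipse, and attractivity of the sublevel sets of the storage
function that contain the largest ellipses. -/
theorem exists_convergence_time {Mbar : ℕ} {D W : Set (Fin 3 → ℝ)} (hDW : D ⊆ W) {gd : Pose}
    {Kc Ke : Matrix I6 I6 ℝ} (hKc : Kc.IsSymm) (hKe : Ke.IsSymm)
    {v : Fin Mbar → (I6 → ℝ) → I6 → ℝ} {Lp Lθ lamt : Fin Mbar → ℝ}
    (hLip : ∀ ψ, IsLipschitzPair W (v ψ) (Lp ψ) (Lθ ψ))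
    (hlamt : ∀ ψ, lamt ψ = lamK Kc Ke - Lp ψ) (hpos : ∀ ψ, 0 < lamt ψ)
    {bs : Fin Mbar → (I6 → ℝ) → ℝ} (hbs0 : ∀ ψ x, 0 ≤ bs ψ x)
    {c : Fin Mbar → (I6 → ℝ) → ℝ} (hc : ∀ ψ x, c ψ x = ellipseSize (lamt ψ) (Lθ ψ) (bs ψ x))
    (hbdd : ∀ ψ, BddAbove (Set.range fun x : poseVecs W => c ψ x))
    {a ε : ℝ} (ha : 0 < a) (hε : 0 < ε) :
    ∃ T ≥ 0, ∀ (mean : Fin Mbar → (I6 → ℝ) → I6 → ℝ) (Φ : Set (Fin Mbar)),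
      (∀ ψ ∈ Φ, ∀ x ∈ poseVecs W, euc (v ψ x - mean ψ x) ≤ bs ψ x) →
      ∀ q : Signals Mbar, IsClosedLoop D W gd Kc Ke v mean q →
        ∀ t₀ ≥ 0, (∀ t ≥ t₀, q.s t ∈ Φ) → euc (q.e gd t₀) ≤ a →
          (∃ t ∈ Set.Icc t₀ (t₀ + T),
            ellipseE (lamK Kc Ke) (lamt (q.s t)) (c (q.s t) (q.gwoBar t).vec)
              (q.gce gd t) (q.gee t) < ε) ∧
          (∀ r, (∀ ψ ∈ Φ, StorageBoundOnEllipse (lamK Kc Ke) (lamt ψ)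
              (⨆ x : poseVecs W, c ψ x) r) →
            ∀ t ≥ t₀ + T, q.S gd t ≤ r + ε) := by
  rcases isEmpty_or_nonempty (Fin Mbar) with hemp | hne
  · exact ⟨0, le_rfl, fun mean Φ _ q => (hemp.false (q.s 0)).elim⟩
  have hc0 : ∀ ψ x, 0 ≤ c ψ x := fun ψ x => by
    rw [hc]; exact ellipseSize_nonneg (hpos ψ) (hLip ψ).2.1 (hbs0 ψ x)
  have hlam : 0 < lamK Kc Ke := by
    obtain ⟨ψ⟩ := hne
    linarith [hlamt ψ, hpos ψ, (hLip ψ).1]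
  have hρ : ∀ ψ, 0 < lamt ψ / lamK Kc Ke := fun ψ => div_pos (hpos ψ) hlam
  have hcbar : ∀ ψ, 0 ≤ ⨆ x : poseVecs W, c ψ x := fun ψ => Real.iSup_nonneg fun x => hc0 ψ x
  choose κ hκ hmargin using fun ψ => exists_margin (hρ ψ) (hcbar ψ) hε
  -- There are finitely many models, so the smallest margin gives a decay rate valid under any
  -- switching.
  obtain ⟨ψ₀, hψ₀⟩ := Finite.exists_min κ
  set lam := lamK Kc Ke
  obtain ⟨κ₀, hκ₀⟩ : ∃ κ₀, κ₀ = lam * κ ψ₀ := ⟨_, rfl⟩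
  have hκ₀pos : 0 < κ₀ := hκ₀ ▸ mul_pos hlam (hκ ψ₀)
  -- The sum serves both claims at once. The extra 1 makes a decrease over time `T` strictly larger
  -- than the initial storage.
  obtain ⟨T, hT⟩ : ∃ T, T = (a ^ 2 + 1) / κ₀ + (a ^ 2 + 1) / (lam * ε ^ 2) := ⟨_, rfl⟩
  have hT₁ : 0 ≤ (a ^ 2 + 1) / κ₀ := by positivity
  have hT₂ : 0 ≤ (a ^ 2 + 1) / (lam * ε ^ 2) := by positivity
  have hTκ : a ^ 2 + 1 ≤ κ₀ * T := by
    have : (a ^ 2 + 1) / κ₀ ≤ T := by linarith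
    rwa [div_le_iff₀' hκ₀pos] at this
  have hTε : a ^ 2 + 1 ≤ lam * ε ^ 2 * T := by
    have : (a ^ 2 + 1) / (lam * ε ^ 2) ≤ T := by linarith
    rwa [div_le_iff₀' (by positivity)] at this
  have hT0 : 0 ≤ T := by linarith
  refine ⟨T, hT0, fun mean Φ hΦ q h t₀ ht₀ hs hat₀ => ?_⟩
  have hderiv : ∀ t > t₀, t ∉ q.J → ∃ S', HasDerivAt (q.S gd) S' t ∧ S' ≤ -(lam *
      ellipseQuad (lamt (q.s t) / lam) (c (q.s t) (q.gwoBar t).vec) (q.gce gd t) (q.gee t)) := by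
    intro t ht htJ
    have ht0 : 0 < t := ht₀.trans_lt ht
    rw [hc]
    exact h.exists_deriv_S_le_ellipseQuad hKc hKe hDW ht0 htJ (hLip _) (hlamt _) (hpos _)
      (hΦ _ (hs t ht.le) _ (Pose.vec_mem_poseVecs (h.estimate_mem t ht0.le)))
  constructor
  -- Staying at `E ≥ ε` throughout would drive the nonnegative storage function below zero.
  · by_contra! hcon
    have hdec := sub_le_mul_sub_of_deriv_le_off_finite (f := q.S gd) (κ := -(lam * ε ^ 2))
      (h.locallyFinite (t₀ + T)) (by linarith : t₀ ≤ t₀ + T)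
      (h.continuousOn_S.mono fun τ hτ => ht₀.trans hτ.1) (by
        intro t ht htF
        obtain ⟨S', hS', hle⟩ := hderiv t ht.1
          fun htJ => htF ⟨htJ, ht₀.trans ht.1.le, ht.2.le⟩
        refine ⟨S', hS', hle.trans (neg_le_neg (mul_le_mul_of_nonneg_left ?_ hlam.le))⟩
        exact sq_le_ellipseQuad (hρ _).le (hc0 _ _) hε.le (hcon t ⟨ht.1.le, ht.2.le⟩))
    have h0 : q.S gd t₀ ≤ a ^ 2 :=
      (h.S_le_sq ht₀).trans (pow_le_pow_left₀ (euc_nonneg _) hat₀ 2)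
    have h1 := h.S_nonneg (by linarith : 0 ≤ t₀ + T)
    rw [add_sub_cancel_left] at hdec
    linarith
  · intro r hr t ht
    have hr0 : 0 ≤ r := (hr _ (hs t₀ le_rfl)).nonneg (hρ _).le (hcbar _)
    refine h.S_le_of_decrease hκ₀pos.le (by linarith) ht₀ (by linarith) hT0 hat₀ ?_ ht
    intro τ hτ hτJ hSτ
    obtain ⟨S', hS', hle⟩ := hderiv τ hτ hτJ
    have hτ0 : 0 < τ := ht₀.trans_lt hτ
    refine ⟨S', hS', hle.trans ?_⟩
    rw [hκ₀]
    refine neg_le_neg (mul_le_mul_of_nonneg_left ?_ hlam.le)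
    obtain ⟨ξ₁, θ₁, h1, hθ₁⟩ := h.angle_ce τ hτ0.le
    obtain ⟨ξ₂, θ₂, h2, hθ₂⟩ := h.angle_ee τ hτ0.le
    -- The margin is found for the largest ellipse; the quadratic only grows when its size is
    -- replaced by the current, smaller one.
    refine (hψ₀ (q.s τ)).trans ((hmargin (q.s τ) r (hr _ (hs τ hτ.le)) _ _
      ⟨ξ₁, θ₁, h1, hθ₁.le⟩ ⟨ξ₂, θ₂, h2, hθ₂.le⟩ hSτ).trans
      (ellipseQuad_antitone (hρ _).le ?_ _ _))
    exact le_ciSup (hbdd (q.s τ))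
      ⟨(q.gwoBar τ).vec, Pose.vec_mem_poseVecs (h.estimate_mem τ hτ0.le)⟩

end VisualPursuit

/-! ### The main theorem -/

theorem theorem2
    -- field of the target, positions of its estimate
    (D W : Set (Fin 3 → ℝ)) (hD : IsCompact D) (hDW : D ⊆ W)
    -- Gaussian process models, one for each motion profile
    {Mbar : ℕ} (M : Fin Mbar → ℕ) (gp : (ψ : Fin Mbar) → GPModel (M ψ))
    (hsf : ∀ ψ, 0 < (gp ψ).sf) (hL : ∀ ψ, (gp ψ).L.PosSemidef)
    (hsn : ∀ ψ i, 0 < (gp ψ).sn i)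
    (hinputs : ∀ ψ j, (gp ψ).inputs j ∈ poseVecs D)
    -- the RKHS of the kernel of each model
    (H : Fin Mbar → Type*) [∀ ψ, NormedAddCommGroup (H ψ)] [∀ ψ, InnerProductSpace ℝ (H ψ)]
    [∀ ψ, CompleteSpace (H ψ)] [∀ ψ, RKHS ℝ (H ψ) (poseVecs W) ℝ]
    (hH : ∀ ψ (x y : poseVecs W), RKHS.kernel (H ψ) x y 1 = (gp ψ).k x y)
    -- motion profiles, with outputs in the RKHS
    (v : Fin Mbar → (I6 → ℝ) → I6 → ℝ) (V : (ψ : Fin Mbar) → I6 → H ψ)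
    (hV : ∀ ψ i (x : poseVecs W), V ψ i x = v ψ x i)
    -- measurement noise
    {Ω : Type*} [MeasurableSpace Ω] (P : Measure Ω) [IsProbabilityMeasure P]
    (noise : (ψ : Fin Mbar) → Fin (M ψ) → I6 → Ω → ℝ)
    (hnoise_meas : ∀ ψ j i, Measurable (noise ψ j i))
    (hnoise_indep : ∀ ψ i, iIndepFun (fun j => noise ψ j i) P)
    (hnoise_sub : ∀ ψ j i, HasSubgaussianMGF (noise ψ j i) (((gp ψ).sn i ^ 2).toNNReal) P)
    -- desired pose and controller gains
    (gd : Pose) (Kc Ke : Matrix I6 I6 ℝ) (hKc : Kc.IsSymm) (hKe : Ke.IsSymm)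
    -- Lipschitz constants, and positivity of `λ_K - L_p`
    (Lp Lθ : Fin Mbar → ℝ) (hLip : ∀ ψ, IsLipschitzPair W (v ψ) (Lp ψ) (Lθ ψ))
    (lamt : Fin Mbar → ℝ) (hlamt : ∀ ψ, lamt ψ = lamK Kc Ke - Lp ψ) (hpos : ∀ ψ, 0 < lamt ψ)
    (δ : ℝ) (hδ0 : 0 < δ) (hδ1 : δ < 1)
    -- posterior means for the outcome `ω` of the noise
    (mean : Ω → Fin Mbar → (I6 → ℝ) → I6 → ℝ)
    (hmean : ∀ ω ψ, mean ω ψ =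
      (gp ψ).mean (fun j i => v ψ ((gp ψ).inputs j) i + noise ψ j i ω))
    -- size of the ellipse of each model
    (c : Fin Mbar → (I6 → ℝ) → ℝ)
    (hc : ∀ ψ x, c ψ x = ellipseSize (lamt ψ) (Lθ ψ)
      ((gp ψ).betaSigma ((gp ψ).beta (poseVecs D) (fun i => ‖V ψ i‖) δ) x)) :
    -- uniform ultimate boundedness under arbitrary switching
    (∀ ω, ∃ b > 0, ∀ a > 0, ∃ T ≥ 0, ∀ q : Signals Mbar,
      IsClosedLoop D W gd Kc Ke v (mean ω) q → ∀ t₀ ≥ 0, euc (q.e gd t₀) ≤ a →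
        ∀ t ≥ t₀ + T, euc (q.e gd t) ≤ b) ∧
    -- high-probability events, one for each model
    ∃ G : Fin Mbar → Set Ω,
      (∀ ψ, MeasurableSet (G ψ) ∧ ENNReal.ofReal (1 - δ ^ 6) ≤ P (G ψ)) ∧
      -- the storage function decreases outside the ellipse of the active model
      (∀ ω, ∀ q : Signals Mbar, IsClosedLoop D W gd Kc Ke v (mean ω) q →
        ∀ t > 0, t ∉ q.J → ω ∈ G (q.s t) →
          ∃ S' : ℝ, HasDerivAt (q.S gd) S' t ∧
            (0 < ellipseE (lamK Kc Ke) (lamt (q.s t)) (c (q.s t) (q.gwoBar t).vec)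
              (q.gce gd t) (q.gee t) → S' < 0)) ∧
      -- convergence, as long as only the models in `Φ` are active
      (∀ Φ : Set (Fin Mbar), ∀ a > 0, ∀ ε > 0, ∃ T ≥ 0, ∀ ω, (∀ ψ ∈ Φ, ω ∈ G ψ) →
        ∀ q : Signals Mbar, IsClosedLoop D W gd Kc Ke v (mean ω) q →
          ∀ t₀ ≥ 0, (∀ t ≥ t₀, q.s t ∈ Φ) → euc (q.e gd t₀) ≤ a →
            -- every neighbourhood of the ellipse is reached
            (∃ t ∈ Set.Icc t₀ (t₀ + T),
              ellipseE (lamK Kc Ke) (lamt (q.s t)) (c (q.s t) (q.gwoBar t).vec)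
                (q.gce gd t) (q.gee t) < ε) ∧
            -- sublevel sets of the storage function that contain the largest ellipses attract
            (∀ r, (∀ ψ ∈ Φ, StorageBoundOnEllipse (lamK Kc Ke) (lamt ψ)
                (⨆ x : poseVecs W, c ψ x) r) →
              ∀ t ≥ t₀ + T, q.S gd t ≤ r + ε)) := by
  have hin : ∀ ψ j, (gp ψ).inputs j ∈ poseVecs W := fun ψ j => poseVecs_mono hDW (hinputs ψ j)
  have hconf : ∀ ω ψ, (∀ i, (gp ψ).NoiseBound (poseVecs D) δ i fun j => noise ψ j i ω) →
      ∀ x ∈ poseVecs W, euc (v ψ x - mean ω ψ x) ≤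
        (gp ψ).betaSigma ((gp ψ).beta (poseVecs D) (fun i => ‖V ψ i‖) δ) x := by
    intro ω ψ hω x hx
    rw [hmean]
    exact GPModel.euc_error_le_betaSigma (hH ψ) (hin ψ) (hsn ψ) (V ψ) (hV ψ)
      (fun j i => noise ψ j i ω) hω hx
  refine ⟨fun ω => ?_, fun ψ => {ω | ∀ i, (gp ψ).NoiseBound (poseVecs D) δ i
    fun j => noise ψ j i ω}, fun ψ => ?_, ?_, ?_⟩
  · rcases isEmpty_or_nonempty (Fin Mbar) with hemp | ⟨⟨ψ₀⟩⟩
    · exact ⟨1, one_pos, fun a _ => ⟨0, le_rfl, fun q => (hemp.false (q.s 0)).elim⟩⟩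
    have hlam : 0 < lamK Kc Ke := by linarith [hlamt ψ₀, hpos ψ₀, (hLip ψ₀).1]
    have hmeanbd : ∀ ψ, ∃ C, ∀ x i, |mean ω ψ x i| ≤ C := fun ψ => by
      rw [hmean]; exact GPModel.exists_abs_mean_le (hL ψ) _
    choose C hC using hmeanbd
    -- Profiles are bounded by the reproducing property and means by the boundedness of the kernel;
    -- no event is involved.
    let B : Fin Mbar → ℝ := fun ψ => ∑ i, (‖V ψ i‖ * (gp ψ).sf + C ψ)
    have hB : ∀ ψ, ∀ g g' : Pose, g.pos ∈ W → g'.pos ∈ W →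
        euc (v ψ g.vec - mean ω ψ g'.vec) ≤ B ψ := by
      intro ψ g g' hg _
      refine (euc_le_sum_abs _).trans (Finset.sum_le_sum fun i _ => ?_)
      refine (abs_sub _ _).trans (add_le_add ?_ (hC ψ _ i))
      rw [← hV ψ i ⟨g.vec, Pose.vec_mem_poseVecs hg⟩]
      exact GPModel.abs_apply_le (hsf ψ) (hH ψ) _ _
    refine IsClosedLoop.exists_ultimate_bound hKc hKe hDW hlam
      (C := ∑ ψ, |B ψ|) fun ψ g g' hg hg' => ?_
    exact (hB ψ g g' hg hg').trans ((le_abs_self _).trans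
      (Finset.single_le_sum (f := fun ψ => |B ψ|) (fun ψ _ => abs_nonneg _) (Finset.mem_univ ψ)))
  · have hmeas : MeasurableSet {ω | ∀ i, (gp ψ).NoiseBound (poseVecs D) δ i
        fun j => noise ψ j i ω} := by
      rw [Set.ofPred_forall]
      exact MeasurableSet.iInter fun i =>
        GPModel.measurableSet_noiseBound (fun j => hnoise_meas ψ j i) _ δ i
    refine ⟨hmeas, ENNReal.ofReal_le_of_le_toReal ?_⟩
    have hcompl : P.real {ω | ∀ i, (gp ψ).NoiseBound (poseVecs D) δ i
        fun j => noise ψ j i ω}ᶜ ≤ δ ^ 6 := by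
      calc _ ≤ P.real (⋃ i, {ω | ¬ (gp ψ).NoiseBound (poseVecs D) δ i fun j => noise ψ j i ω}) := by
            refine measureReal_mono fun ω hω => ?_
            obtain ⟨i, hi⟩ := not_forall.1 hω
            exact Set.mem_iUnion.2 ⟨i, hi⟩
        _ ≤ ∑ i, P.real {ω | ¬ (gp ψ).NoiseBound (poseVecs D) δ i fun j => noise ψ j i ω} :=
            measureReal_iUnion_fintype_le _
        _ ≤ ∑ _i : I6, δ ^ 6 / 6 := Finset.sum_le_sum fun i _ =>
            GPModel.measureReal_not_noiseBound_le (hnoise_indep ψ i) (fun j => hnoise_sub ψ j i)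
              (hL ψ) (hsn ψ i) (GPModel.posSemidef_gramOf_inputs (hH ψ) (hin ψ)) (hinputs ψ)
              hδ0 hδ1
        _ = δ ^ 6 := by
            rw [Finset.sum_const, Finset.card_univ, Fintype.card_sum, Fintype.card_fin,
              nsmul_eq_mul]
            push_cast
            ring
    rw [probReal_compl_eq_one_sub hmeas] at hcompl
    change _ ≤ P.real _
    linarith
  · intro ω q h t ht htJ hω
    obtain ⟨S', hS', hle⟩ := h.exists_deriv_S_le_ellipseQuad hKc hKe hDW ht htJ (hLip _)
      (hlamt _) (hpos _)
      (hconf ω _ hω _ (Pose.vec_mem_poseVecs (h.estimate_mem t ht.le)))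
    rw [← hc] at hle
    refine ⟨S', hS', fun hE => hle.trans_lt ?_⟩
    have hlam : 0 < lamK Kc Ke := by
      linarith [hlamt (q.s t), hpos (q.s t), (hLip (q.s t)).1]
    have hc0 : 0 ≤ c (q.s t) (q.gwoBar t).vec := by
      rw [hc]; exact ellipseSize_nonneg (hpos _) (hLip _).2.1 (GPModel.betaSigma_nonneg _ _)
    exact neg_neg_of_pos (mul_pos hlam (ellipseQuad_pos (div_pos (hpos _) hlam).le hc0 hE))
  · intro Φ a ha ε hε
    -- Without this bound the supremum of the sizes could take the default value 0 instead of
    -- dominating them.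
    have hbdd : ∀ ψ, BddAbove (Set.range fun x : poseVecs W => c ψ x) := by
      intro ψ
      refine ⟨ellipseSize (lamt ψ) (Lθ ψ)
        (∑ i, |(gp ψ).beta (poseVecs D) (fun i => ‖V ψ i‖) δ i| * (gp ψ).sf), ?_⟩
      rintro _ ⟨x, rfl⟩
      simp only [hc, ellipseSize]
      have h1 := GPModel.betaSigma_le (hsf ψ) (hH ψ) (hin ψ) (hsn ψ)
        ((gp ψ).beta (poseVecs D) (fun i => ‖V ψ i‖) δ) x
      have h2 : 0 ≤ 1 / (2 * lamt ψ) := by have := hpos ψ; positivity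
      linarith [mul_le_mul_of_nonneg_left h1 h2]
    obtain ⟨T, hT, H⟩ := exists_convergence_time (gd := gd) hDW hKc hKe hLip hlamt hpos
      (fun ψ x => GPModel.betaSigma_nonneg _ _) hc hbdd ha hε
    exact ⟨T, hT, fun ω hω q h => H (mean ω) Φ (fun ψ hψ => hconf ω ψ (hω ψ hψ)) q h⟩
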